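/- Let $\mathcal{K}$ be a chiral abstract $n$-polytope of type $\{p_1,\dots,p_{n-1}\}$, where $p_i\in\{2,3,\dots,\infty\}$. Here a polytope is chiral if it is rotary (its rotation group, i.e. the group of automorphisms preserving the set of white flags, is transitive on white flags) but its automorphism group is not transitive on all flags. Assume that $\mathcal{K}$ covers a regular $n$-maniplex $\mathcal{R}$ with at least two facets, i.e. there is a surjective colour-preserving map from the flag graph of $\mathcal{K}$ onto $\mathcal{R}$. Let $\mathcal{P}$ be a chiral extension of $\mathcal{K}$ (a chiral $(n+1)$-polytope all of whose facets are isomorphic to $\mathcal{K}$) of type $\{p_1,\dots,p_{n-1},q\}$, $q\in\{2,3,\dots,\infty\}$. Then for every integer $s\ge 1$, $\mathcal{K}$ has a chiral extension $\mathcal{Q}$ of type $\{p_1,\dots,p_{n-1},\operatorname{lcm}(q,2s)\}$, where $\operatorname{lcm}(\infty,2s)=\infty$. Moreover, fix any base flags $\Phi_0$ of $\mathcal{P}$ and $x_0$ of $\mathcal{R}$. Then $\mathcal{Q}$ and a base flag of it can be chosen so that the rotation group of $\mathcal{Q}$ is the mix of the rotation groups of $\mathcal{P}$ and of $2s^{\mathcal{R}-1}$.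 That is, there is an isomorphism $$\operatorname{Aut}^+(\mathcal{Q})\;\cong\;\langle(\sigma_1,\sigma_1'),\dots,(\sigma_n,\sigma_n')\rangle\le \operatorname{Aut}^+(\mathcal{P})\times\operatorname{Aut}^+(2s^{\mathcal{R}-1})$$ which sends the $i$-th abstract rotation of $\mathcal{Q}$ to $(\sigma_i,\sigma_i')$, where $\sigma_i$ and $\sigma'_i$ are the abstract rotations with respect to the base flags (the $i$-th abstract rotation is the automorphism that sends the base flag $\Phi$ to $(\Phi^{i})^{i-1}$, the $(i-1)$-adjacent flag of the $i$-adjacent flag of $\Phi$). The $(n+1)$-maniplex $2s^{\mathcal{R}-1}$ is defined as follows. Let $U$ be the group of finitely supported $\mathbb{Z}/s$-valued vectors with sum zero that are indexed by the facets of $\mathcal{R}$. Let $e_j$ be the standard unit vectors, let $a_j=e_j-e_0$, where $0$ denotes the facet containing $x_0$, and let $r_0,\dots,r_{n-1}$ be the adjacency permutations of the flags of $\mathcal{R}$. The flags of $2s^{\mathcal{R}-1}$ are the triples $(x,v,\delta)$ with $x$ a flag of $\mathcal{R}$, $v\in U$ and $\delta\in\{0,1\}$. The adjacency permutations are $\hat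 r_i(x,v,\delta)=(r_ix,v,\delta)$ for $0\le i\le n-1$ and $\hat r_n(x,v,\delta)=(x,v+(-1)^\delta a_j,1-\delta)$, where $j$ is the facet containing $x$. The base flag is $(x_0,0,0)$. -/

import Mathlib

universe u

noncomputable section

/-! ### Abstract polytopes -/

/-- The rank of a face: the length of a longest chain of faces ending in it, minus one.  When all
flags of a bounded poset have `n + 2` elements, the least face has rank `-1`, the greatest has rank
`n`, and any other face `F` has as rank the number of faces strictly between the least face and
`F` in any flag through `F`. -/
def faceRank {α : Type u} [PartialOrder α] (F : α) : ℤ :=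
  ((Order.height F).toNat : ℤ) - 1

/-- Two flags (maximal chains) are `i`-adjacent if they differ exactly in the face of rank `i`. -/
def FlagAdj {α : Type u} [PartialOrder α] (i : ℤ) (Φ Ψ : Flag α) : Prop :=
  Φ ≠ Ψ ∧ ∀ F : α, faceRank F ≠ i → (F ∈ Φ ↔ F ∈ Ψ)

/-- `α` is an abstract polytope of rank `n`. -/
structure IsPolytope (n : ℕ) (α : Type u) [PartialOrder α] [BoundedOrder α] : Prop where
  flag_card : ∀ Φ : Flag α, (Φ : Set α).ncard = n + 2
  diamond : ∀ i : ℕ, i < n → ∀ F H : α, faceRank F = (i : ℤ) - 1 → faceRank H = (i : ℤ) + 1 →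
    F ≤ H → {G : α | F < G ∧ G < H}.ncard = 2
  strongly_flag_connected : ∀ Φ Ψ : Flag α,
    Relation.ReflTransGen
      (fun A B : Flag α => (∃ i : ℤ, FlagAdj i A B) ∧ (Φ : Set α) ∩ Ψ ⊆ B) Φ Ψ

/-- The polytope `α` of rank `n` is of type `{p 1, …, p (n - 1)}`: for each `i` with
`1 ≤ i ≤ n - 1` every section `G / F` of rank 2, with `F` of rank `i - 2` and `G` of rank `i + 1`,
is a `p i`-gon, that is, it has exactly `p i` vertices.
Values of `p` outside `1, …, n - 1` play no role. -/
def HasSchlafliType (n : ℕ) (α : Type u) [PartialOrder α] (p : ℕ → ℕ∞) : Prop :=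
  ∀ i : ℕ, 1 ≤ i → i < n → ∀ F G : α,
    faceRank F = (i : ℤ) - 2 → faceRank G = (i : ℤ) + 1 → F ≤ G →
      {H : α | F ≤ H ∧ H ≤ G ∧ faceRank H = (i : ℤ) - 1}.encard = p i

/-- The polytope `P` of rank `n + 1` is an extension of `K`: each of its facets, seen as a section
`F / F₋₁`, is isomorphic to `K`. -/
def IsExtension (n : ℕ) (K P : Type u) [PartialOrder K] [PartialOrder P] : Prop :=
  ∀ F : P, faceRank F = (n : ℤ) → Nonempty (Set.Iic F ≃o K)

/-! ### Symmetries of polytopes -/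

/-- All flags are equivalent under the automorphism group. -/
def IsRegularPolytope (α : Type u) [PartialOrder α] : Prop :=
  ∀ Φ Ψ : Flag α, ∃ γ : α ≃o α, Flag.map γ Φ = Ψ

/-- A proper 2-colouring of the flag graph; the polytope is orientable if there is one. -/
def IsFlagColouring {α : Type u} [PartialOrder α] (c : Flag α → Bool) : Prop :=
  ∀ (i : ℤ) (Φ Ψ : Flag α), FlagAdj i Φ Ψ → c Φ ≠ c Ψ

/-- The white flags with respect to the base flag `Φ₀`: the flags on the same part of the flag
graph as `Φ₀` if it is bipartite, and all flags if it is not. -/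
def whiteFlags {α : Type u} [PartialOrder α] (Φ₀ : Flag α) : Set (Flag α) :=
  {Ψ | ∀ c : Flag α → Bool, IsFlagColouring c → c Ψ = c Φ₀}

/-- The rotation group: the automorphisms that permute the white flags. -/
def rotationGroup {α : Type u} [PartialOrder α] (Φ₀ : Flag α) : Subgroup (α ≃o α) where
  carrier := {γ | ∀ Ψ : Flag α, Flag.map γ Ψ ∈ whiteFlags Φ₀ ↔ Ψ ∈ whiteFlags Φ₀}
  one_mem' := by
    intro Ψ
    have h : Flag.map (1 : α ≃o α) Ψ = Ψ := by
      apply Flag.ext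
      simp
    rw [h]
  mul_mem' := by
    intro a b ha hb Ψ
    have h : Flag.map (a * b) Ψ = Flag.map a (Flag.map b Ψ) := by
      apply Flag.ext
      simp only [Flag.coe_map, Set.image_image]
      rfl
    rw [h, ha, hb]
  inv_mem' := by
    intro a ha Ψ
    have h : Flag.map a (Flag.map a⁻¹ Ψ) = Ψ := by
      apply Flag.ext
      simp only [Flag.coe_map, Set.image_image]
      simp
    rw [← ha, h]

/-- The rotation group is transitive on the white flags. -/
def IsRotaryPolytope (α : Type u) [PartialOrder α] : Prop :=
  ∀ Φ₀ : Flag α, ∀ Φ ∈ whiteFlags Φ₀, ∀ Ψ ∈ whiteFlags Φ₀,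
    ∃ γ ∈ rotationGroup Φ₀, Flag.map γ Φ = Ψ

/-- A polytope is chiral if it is rotary but not regular. -/
def IsChiralPolytope (α : Type u) [PartialOrder α] : Prop :=
  IsRotaryPolytope α ∧ ¬ IsRegularPolytope α

/-- `γ` is the abstract rotation `σ_i` with respect to the base flag `Φ₀`: it maps `Φ₀` to the
`(i - 1)`-adjacent flag of the `i`-adjacent flag of `Φ₀`. -/
def IsAbstractRotation {α : Type u} [PartialOrder α] (Φ₀ : Flag α) (i : ℕ) (γ : α ≃o α) : Prop :=
  1 ≤ i ∧ ∃ Φ₁ : Flag α, FlagAdj (i : ℤ) Φ₀ Φ₁ ∧ FlagAdj ((i : ℤ) - 1) Φ₁ (Flag.map γ Φ₀)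

/-! ### Maniplexes -/

/-- A maniplex of rank `n`: `r i x` is the flag joined to the flag `x` by the edge of colour
`i`. -/
structure Maniplex (n : ℕ) where
  Flags : Type u
  r : Fin n → Equiv.Perm Flags
  nonempty : Nonempty Flags
  involutive : ∀ i x, r i (r i x) = x
  fixed_point_free : ∀ i x, r i x ≠ x
  distinct : ∀ i j x, i ≠ j → r i x ≠ r j x
  squares : ∀ i j : Fin n, (i : ℕ) + 2 ≤ j → ∀ x, r i (r j x) = r j (r i x)
  connected : ∀ x y, ∃ g ∈ Subgroup.closure (Set.range r), g x = y

namespace Maniplex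

/-- The automorphism group: the permutations of the flags that commute with all the `r i`. -/
def aut {n : ℕ} (M : Maniplex.{u} n) : Subgroup (Equiv.Perm M.Flags) :=
  Subgroup.centralizer (Set.range M.r)

/-- A maniplex is regular if its automorphism group is transitive on flags. -/
def IsRegular {n : ℕ} (M : Maniplex.{u} n) : Prop :=
  ∀ x y : M.Flags, ∃ γ ∈ M.aut, γ x = y

/-- The group generated by the `r i` with `i ≠ n - 1`. -/
def facetGroup {n : ℕ} (M : Maniplex.{u} n) : Subgroup (Equiv.Perm M.Flags) :=
  Subgroup.closure {g | ∃ i : Fin n, (i : ℕ) + 1 < n ∧ g = M.r i}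

/-- The set of flags of the facet that contains the flag `x`. -/
def facetSet {n : ℕ} (M : Maniplex.{u} n) (x : M.Flags) : Set M.Flags :=
  {y | ∃ g ∈ M.facetGroup, g x = y}

/-- The facets: the connected components left when the edges of colour `n - 1` are removed. -/
def Facet {n : ℕ} (M : Maniplex.{u} n) : Type u :=
  {S : Set M.Flags // ∃ x, S = M.facetSet x}

/-- The facet that contains the flag `x`. -/
def facetOf {n : ℕ} (M : Maniplex.{u} n) (x : M.Flags) : M.Facet :=
  ⟨M.facetSet x, x, rfl⟩

/-- `γ` is the abstract rotation `σ_i` with respect to the base flag `x₀`. -/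
def IsAbstractRotation {n : ℕ} (M : Maniplex.{u} n) (x₀ : M.Flags) (i : ℕ) (γ : M.aut) : Prop :=
  ∃ a b : Fin n, (a : ℕ) + 1 = i ∧ (b : ℕ) = i ∧
    (γ : Equiv.Perm M.Flags) x₀ = M.r a (M.r b x₀)

end Maniplex

/-- The polytope `K` of rank `n` covers the maniplex `R`, i.e. `R` is a quotient of `K`: there is a
colour-preserving map from the flag graph of `K` onto `R`. -/
def PolytopeCovers {n : ℕ} (K : Type u) [PartialOrder K] (R : Maniplex.{u} n) : Prop :=
  ∃ φ : Flag K → R.Flags, Function.Surjective φ ∧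
    ∀ (i : Fin n) (Φ Ψ : Flag K), FlagAdj ((i : ℕ) : ℤ) Φ Ψ → φ Ψ = R.r i (φ Φ)

/-! ### The maniplex `2s^(M - 1)` -/

namespace Maniplex

/-- The finitely supported vectors indexed by the facets of `M`, with entries in `ℤ/s` and with
sum zero. -/
def vectorGroup {n : ℕ} (M : Maniplex.{u} n) (s : ℕ) : AddSubgroup (M.Facet →₀ ZMod s) :=
  (Finsupp.liftAddHom (fun _ : M.Facet => AddMonoidHom.id (ZMod s))).ker

/-- The vector `a_j = e_j - e_0`, where `0` stands for the facet of the base flag `x₀`. -/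
def facetVector {n : ℕ} (M : Maniplex.{u} n) (x₀ : M.Flags) (s : ℕ) (j : M.Facet) :
    M.vectorGroup s :=
  ⟨Finsupp.single j 1 - Finsupp.single (M.facetOf x₀) 1, by
    rw [vectorGroup, AddMonoidHom.mem_ker, map_sub, Finsupp.liftAddHom_apply_single,
      Finsupp.liftAddHom_apply_single]
    simp⟩

theorem facetOf_r {n : ℕ} (M : Maniplex.{u} n) (i : Fin n) (hi : (i : ℕ) + 1 < n) (x : M.Flags) :
    M.facetOf (M.r i x) = M.facetOf x := by
  have hmem : M.r i ∈ M.facetGroup := Subgroup.subset_closure ⟨i, hi, rfl⟩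
  apply Subtype.ext
  ext y
  constructor
  · rintro ⟨g, hg, h⟩
    exact ⟨g * M.r i, mul_mem hg hmem, h⟩
  · rintro ⟨g, hg, h⟩
    refine ⟨g * M.r i, mul_mem hg hmem, ?_⟩
    rw [Equiv.Perm.mul_apply, M.involutive]
    exact h

/-- The flags of `2s^(M - 1)`; the last coordinate is the element of `ℤ/2`, with `true` for `1`. -/
abbrev TwoSFlags {n : ℕ} (M : Maniplex.{u} n) (s : ℕ) : Type u :=
  M.Flags × M.vectorGroup s × Bool

/-- The permutation of the flags of `2s^(M - 1)` of colour `i ≤ n - 1`. -/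
def twoSLower {n : ℕ} (M : Maniplex.{u} n) (s : ℕ) (i : Fin n) :
    Equiv.Perm (M.TwoSFlags s) :=
  Function.Involutive.toPerm (fun z => (M.r i z.1, z.2)) (by
    rintro ⟨x, v, d⟩
    simp [M.involutive])

/-- The permutation of the flags of `2s^(M - 1)` of colour `n`:
`(x, v, δ) ↦ (x, v + (-1)^δ a_j, 1 - δ)`, where `j` is the facet of `x`. -/
def twoSLast {n : ℕ} (M : Maniplex.{u} n) (x₀ : M.Flags) (s : ℕ) :
    Equiv.Perm (M.TwoSFlags s) :=
  Function.Involutive.toPerm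
    (fun z => (z.1, (if z.2.2 = true then z.2.1 - M.facetVector x₀ s (M.facetOf z.1)
      else z.2.1 + M.facetVector x₀ s (M.facetOf z.1)), !z.2.2)) (by
    rintro ⟨x, v, d⟩
    cases d <;> simp)

/-- The permutations of the flags of `2s^(M - 1)` for the colours `0, …, n`. -/
def twoSPerm {n : ℕ} (M : Maniplex.{u} n) (x₀ : M.Flags) (s : ℕ) :
    Fin (n + 1) → Equiv.Perm (M.TwoSFlags s) :=
  Fin.lastCases (M.twoSLast x₀ s) (M.twoSLower s)

@[simp] theorem twoSPerm_last {n : ℕ} (M : Maniplex.{u} n) (x₀ : M.Flags) (s : ℕ) :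
    M.twoSPerm x₀ s (Fin.last n) = M.twoSLast x₀ s := by
  simp [twoSPerm]

@[simp] theorem twoSPerm_castSucc {n : ℕ} (M : Maniplex.{u} n) (x₀ : M.Flags) (s : ℕ)
    (i : Fin n) : M.twoSPerm x₀ s i.castSucc = M.twoSLower s i := by
  simp [twoSPerm]

@[simp] theorem twoSLower_apply {n : ℕ} (M : Maniplex.{u} n) (s : ℕ) (i : Fin n) (x : M.Flags)
    (v : M.vectorGroup s) (d : Bool) : M.twoSLower s i (x, v, d) = (M.r i x, v, d) := rfl

@[simp] theorem twoSLast_apply {n : ℕ} (M : Maniplex.{u} n) (x₀ : M.Flags) (s : ℕ) (x : M.Flags)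
    (v : M.vectorGroup s) (d : Bool) : M.twoSLast x₀ s (x, v, d) =
      (x, (if d = true then v - M.facetVector x₀ s (M.facetOf x)
        else v + M.facetVector x₀ s (M.facetOf x)), !d) := rfl

theorem twoS_connected {n : ℕ} (M : Maniplex.{u} n) (x₀ : M.Flags) (s : ℕ)
    (z w : M.TwoSFlags s) :
    ∃ g ∈ Subgroup.closure (Set.range (M.twoSPerm x₀ s)), g z = w := by
  set G := Subgroup.closure (Set.range (M.twoSPerm x₀ s)) with hG
  have htrans : ∀ a b c : M.TwoSFlags s, (∃ g ∈ G, g a = b) → (∃ g ∈ G, g b = c) →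
      ∃ g ∈ G, g a = c := by
    rintro a b c ⟨g, hg, rfl⟩ ⟨h, hh, rfl⟩
    exact ⟨h * g, mul_mem hh hg, rfl⟩
  have hsymm : ∀ a b : M.TwoSFlags s, (∃ g ∈ G, g a = b) → ∃ g ∈ G, g b = a := by
    rintro a b ⟨g, hg, rfl⟩
    exact ⟨g⁻¹, inv_mem hg, by simp⟩
  have hlastmem : M.twoSLast x₀ s ∈ G :=
    Subgroup.subset_closure ⟨Fin.last n, M.twoSPerm_last x₀ s⟩
  have hlift : ∀ g ∈ Subgroup.closure (Set.range M.r), ∃ h ∈ G, ∀ x v d,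
      h (x, v, d) = (g x, v, d) := by
    intro g hg
    induction hg using Subgroup.closure_induction with
    | mem g hg =>
      obtain ⟨i, rfl⟩ := hg
      exact ⟨M.twoSLower s i, Subgroup.subset_closure ⟨i.castSucc, M.twoSPerm_castSucc x₀ s i⟩,
        fun x v d => rfl⟩
    | one => exact ⟨1, one_mem _, fun x v d => rfl⟩
    | mul a b _ _ iha ihb =>
      obtain ⟨a', ha', ha⟩ := iha
      obtain ⟨b', hb', hb⟩ := ihb
      exact ⟨a' * b', mul_mem ha' hb', fun x v d => by
        rw [Equiv.Perm.mul_apply, hb, ha, Equiv.Perm.mul_apply]⟩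
    | inv a _ iha =>
      obtain ⟨a', ha', ha⟩ := iha
      refine ⟨a'⁻¹, inv_mem ha', fun x v d => ?_⟩
      rw [Equiv.Perm.inv_eq_iff_eq, ha]
      simp
  have hmove : ∀ x y v d, ∃ g ∈ G, g (x, v, d) = (y, v, d) := by
    intro x y v d
    obtain ⟨g, hg, hxy⟩ := M.connected x y
    obtain ⟨h, hh, hh2⟩ := hlift g hg
    exact ⟨h, hh, by rw [hh2, hxy]⟩
  have hflip : ∀ v, ∃ g ∈ G, g (x₀, v, false) = (x₀, v, true) := by
    intro v
    refine ⟨_, hlastmem, ?_⟩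
    have h0 : M.facetVector x₀ s (M.facetOf x₀) = 0 := by
      apply Subtype.ext
      simp [facetVector]
    simp [h0]
  have hstep : ∀ j v, ∃ g ∈ G, g (x₀, v, false) = (x₀, v + M.facetVector x₀ s j, false) := by
    rintro ⟨S, x, rfl⟩ v
    refine htrans _ _ _ (hmove x₀ x v false) ?_
    refine htrans _ (x, v + M.facetVector x₀ s (M.facetOf x), true) _
      ⟨_, hlastmem, by simp⟩ ?_
    refine htrans _ _ _ (hmove x x₀ _ true) ?_
    exact hsymm _ _ (hflip _)
  let T : AddSubgroup (M.vectorGroup s) :=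
    { carrier := {t | ∀ v, ∃ g ∈ G, g (x₀, v, false) = (x₀, v + t, false)}
      zero_mem' := fun v => ⟨1, one_mem _, by simp⟩
      add_mem' := fun {a b} ha hb v => by
        refine htrans _ _ _ (ha v) ?_
        rw [← add_assoc]
        exact hb (v + a)
      neg_mem' := fun {a} ha v => by
        apply hsymm
        have := ha (v + -a)
        rwa [neg_add_cancel_right] at this }
  have hgen : ∀ y : M.Facet →₀ ZMod s, ∃ t ∈ T, (t : M.Facet →₀ ZMod s) =
      y - Finsupp.single (M.facetOf x₀)
        (Finsupp.liftAddHom (fun _ : M.Facet => AddMonoidHom.id (ZMod s)) y) := by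
    intro y
    induction y using Finsupp.induction_linear with
    | zero => exact ⟨0, zero_mem _, by simp⟩
    | add a b iha ihb =>
      obtain ⟨t, ht, h1⟩ := iha
      obtain ⟨t', ht', h2⟩ := ihb
      refine ⟨t + t', add_mem ht ht', ?_⟩
      rw [AddSubgroup.coe_add, h1, h2, map_add, Finsupp.single_add]
      abel
    | single j c =>
      obtain ⟨k, rfl⟩ := ZMod.intCast_surjective c
      have hj : M.facetVector x₀ s j ∈ T := hstep j
      refine ⟨k • M.facetVector x₀ s j, zsmul_mem hj k, ?_⟩
      simp [facetVector, smul_sub]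
  have hbase : ∀ z : M.TwoSFlags s, ∃ g ∈ G, g (x₀, 0, false) = z := by
    rintro ⟨x, v, d⟩
    refine htrans _ (x₀, v, false) _ ?_ ?_
    · obtain ⟨t, ht, h⟩ := hgen v
      have hv : Finsupp.liftAddHom (fun _ : M.Facet => AddMonoidHom.id (ZMod s))
          (v : M.Facet →₀ ZMod s) = 0 := v.2
      rw [hv, Finsupp.single_zero, sub_zero] at h
      have htv : t = v := Subtype.ext h
      have := ht 0
      rwa [zero_add, htv] at this
    · cases d with
      | false => exact hmove _ _ _ _
      | true => exact htrans _ _ _ (hflip v) (hmove _ _ _ _)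
  exact htrans _ _ _ (hsymm _ _ (hbase z)) (hbase w)

/-- The maniplex `2s^(M - 1)` of rank `n + 1`, for a maniplex `M` of rank `n` with base flag
`x₀`. -/
def twoS {n : ℕ} (M : Maniplex.{u} n) (x₀ : M.Flags) (s : ℕ) : Maniplex.{u} (n + 1) where
  Flags := M.TwoSFlags s
  r := M.twoSPerm x₀ s
  nonempty := ⟨(x₀, 0, false)⟩
  involutive := by
    rintro i ⟨x, v, d⟩
    induction i using Fin.lastCases with
    | last => cases d <;> simp
    | cast i => simp [M.involutive]
  fixed_point_free := by
    rintro i ⟨x, v, d⟩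
    induction i using Fin.lastCases with
    | last => simp
    | cast i => simp [M.fixed_point_free]
  distinct := by
    rintro i j ⟨x, v, d⟩ hij
    induction i using Fin.lastCases with
    | last =>
      induction j using Fin.lastCases with
      | last => exact absurd rfl hij
      | cast j => simp
    | cast i =>
      induction j using Fin.lastCases with
      | last => simp
      | cast j =>
        have hne : i ≠ j := fun h => hij (by rw [h])
        simp [M.distinct i j x hne]
  squares := by
    rintro i j hij ⟨x, v, d⟩
    induction i using Fin.lastCases with
    | last =>
      have := j.isLt
      simp only [Fin.val_last] at hij
      omega
    | cast i =>
      induction j using Fin.lastCases with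
      | last =>
        have hi : (i : ℕ) + 1 < n := by
          simp only [Fin.val_last, Fin.val_castSucc] at hij
          omega
        simp [M.facetOf_r i hi]
      | cast j =>
        have hh : (i : ℕ) + 2 ≤ j := by simpa using hij
        simp [M.squares i j hh x]
  connected := M.twoS_connected x₀ s

/-- The base flag of `2s^(M - 1)`. -/
def twoSBase {n : ℕ} (M : Maniplex.{u} n) (x₀ : M.Flags) (s : ℕ) : (M.twoS x₀ s).Flags :=
  (x₀, 0, false)

end Maniplex

/-! ### Mixing, and least common multiples of entries of Schläfli symbols -/

/-- The mix of the rotation groups of a rotary polytope and a rotary maniplex: the subgroup of the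
direct product generated by the pairs of corresponding abstract rotations. -/
def rotationMix {n : ℕ} {P : Type u} [PartialOrder P] (Φ₀ : Flag P) (M : Maniplex.{u} n)
    (x₀ : M.Flags) : Subgroup ((P ≃o P) × M.aut) :=
  Subgroup.closure {g | ∃ i : ℕ, IsAbstractRotation Φ₀ i g.1 ∧ M.IsAbstractRotation x₀ i g.2}

/-- The least common multiple of `q ∈ {2, 3, …, ∞}` and a positive integer, which is `∞` if
`q = ∞`. -/
def lcmTop (q : ℕ∞) (m : ℕ) : ℕ∞ :=
  if q = ⊤ then ⊤ else ((Nat.lcm q.toNat m : ℕ) : ℕ∞)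

end

/-! The polytope `Q` is the poset of faces of the mix `X` of the flag graph of `P` with `T`, the
maniplex `2s^(R - 1)`: the flags of `X` are the pairs reachable from the pair of base flags.
Everything is read off the projection of `X` onto the flags of `P`.

Polytopality. Each facet of `P` is a copy of `K`, so it covers `R`, and by regularity of `R` the
covering can be given any value at one chosen flag. The colours below `n` leave `(v, δ)` alone and
move the `R`-coordinate as they move the image under the covering. So inside one facet of `X` the
`T`-coordinate is a function of the `P`-coordinate: the projection is injective on facets
(`mix_twoS_injOn_facet`). By a quotient criterion (`Maniplex.IsPolytopal.of_cover`) `X` inherits the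
path intersection property of the flag graph of `P`. Hence its poset is a polytope
(`Maniplex.IsPolytopal.isPolytope`), with the same facets as `P`
(`Maniplex.nonempty_facet_orderIso`).

Symmetry. Since `R` is regular, `T` has all abstract rotations
(`Maniplex.exists_twoS_abstractRotation`). Pairs of corresponding abstract rotations act on `X`, and
the group they generate, the mix, has at most two orbits on flags (`Maniplex.exists_apply_eq`). As
`P` is chiral, its flags have a proper 2-colouring; pulled back to `X`, it is preserved by the mix
and separates the two orbits. So the mix acts faithfully as the full rotation group of `Q`, and `Q`
is rotary. It is not regular, because regularity would descend to the facet `K`.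

Type. All entries but the last are those of `K`. In an orientable polytope the last entry is the
period of a flag under the product of the last two adjacency permutations, with period `0` standing
for `∞`. Periods in a mix are least common multiples, and in `T` the period is `2 * s`
(`Maniplex.minimalPeriod_twoS`); there the two facets of `R` are needed. -/

/-! ### Paths in edge-coloured graphs given by permutations -/

/-- `y` can be reached from `x` by a path with colours in `I`. -/
def Linked {ι X : Type*} (r : ι → Equiv.Perm X) (I : Set ι) : X → X → Prop :=
  Relation.ReflTransGen (fun a b => ∃ i ∈ I, b = r i a)

namespace Linked

variable {ι X Y : Type*} {r : ι → Equiv.Perm X} {r' : ι → Equiv.Perm Y} {I J A B : Set ι}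
  {x y z : X}

theorem refl (x : X) : Linked r I x x := Relation.ReflTransGen.refl

theorem trans (h : Linked r I x y) (h' : Linked r I y z) : Linked r I x z :=
  Relation.ReflTransGen.trans h h'

theorem step {i : ι} (hi : i ∈ I) (x : X) : Linked r I x (r i x) :=
  Relation.ReflTransGen.single ⟨i, hi, rfl⟩

theorem tail {i : ι} (h : Linked r I x y) (hi : i ∈ I) : Linked r I x (r i y) :=
  h.trans (step hi y)

theorem mono (hIJ : I ⊆ J) (h : Linked r I x y) : Linked r J x y :=
  Relation.ReflTransGen.mono (fun _ _ ⟨i, hi, e⟩ => ⟨i, hIJ hi, e⟩) _ _ h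

theorem symm (hr : ∀ i x, r i (r i x) = x) (h : Linked r I x y) : Linked r I y x := by
  induction h with
  | refl => exact refl _
  | tail _ hs ih =>
    obtain ⟨i, hi, rfl⟩ := hs
    refine trans ?_ ih
    have := step (r := r) hi (r i ‹_›)
    rwa [hr] at this

theorem map (f : X → Y) (hf : ∀ i ∈ I, ∀ x, f (r i x) = r' i (f x)) (h : Linked r I x y) :
    Linked r' I (f x) (f y) := by
  induction h with
  | refl => exact refl _
  | tail _ hs ih =>
    obtain ⟨i, hi, rfl⟩ := hs
    rw [hf i hi]
    exact ih.tail hi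

/-- Path lifting: the colours of a path downstairs prescribe a path upstairs. It is how facts about
`P` are carried to a cover of its flag graph. -/
theorem lift (f : X → Y) (hf : ∀ i ∈ I, ∀ x, f (r i x) = r' i (f x)) {w : Y}
    (h : Linked r' I (f x) w) : ∃ y, Linked r I x y ∧ f y = w := by
  induction h with
  | refl => exact ⟨x, refl _, rfl⟩
  | tail _ hs ih =>
    obtain ⟨i, hi, rfl⟩ := hs
    obtain ⟨y, hy, rfl⟩ := ih
    exact ⟨r i y, hy.tail hi, hf i hi y⟩

theorem eq_of_invariant {β : Type*} (f : X → β) (hf : ∀ i ∈ I, ∀ x, f (r i x) = f x)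
    (h : Linked r I x y) : f y = f x := by
  induction h with
  | refl => rfl
  | tail _ hs ih =>
    obtain ⟨i, hi, rfl⟩ := hs
    rw [hf i hi, ih]

/-- A new step of colour in `A` is moved in front of the `B`-part by applying its permutation to
that whole part, which stays a `B`-path by commutation. -/
theorem split (hc : ∀ a ∈ A, ∀ b ∈ B, ∀ x, r a (r b x) = r b (r a x)) (hI : I ⊆ A ∪ B)
    (h : Linked r I x y) : ∃ z, Linked r A x z ∧ Linked r B z y := by
  induction h with
  | refl => exact ⟨x, refl _, refl _⟩
  | tail _ hs ih =>
    obtain ⟨i, hi, rfl⟩ := hs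
    obtain ⟨z, hz, hy⟩ := ih
    rcases hI hi with hi | hi
    · exact ⟨r i z, hz.tail hi, hy.map (r i) (fun b hb x => hc i hi b hb x)⟩
    · exact ⟨z, hz, hy.tail hi⟩

theorem eq_of_empty (h : Linked r ∅ x y) : y = x :=
  eq_of_invariant id (fun _ hi => hi.elim) h

theorem eq_or_eq_of_singleton (hr : ∀ i x, r i (r i x) = x) {i : ι} (h : Linked r {i} x y) :
    y = x ∨ y = r i x := by
  induction h with
  | refl => exact Or.inl rfl
  | tail _ hs ih =>
    obtain ⟨j, rfl, rfl⟩ := hs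
    rcases ih with rfl | rfl
    · exact Or.inr rfl
    · exact Or.inl (hr _ _)

theorem exists_mem_closure (h : Linked r I x y) :
    ∃ g ∈ Subgroup.closure (r '' I), g x = y := by
  induction h with
  | refl => exact ⟨1, one_mem _, rfl⟩
  | tail _ hs ih =>
    obtain ⟨i, hi, rfl⟩ := hs
    obtain ⟨g, hg, rfl⟩ := ih
    exact ⟨r i * g, mul_mem (Subgroup.subset_closure ⟨i, hi, rfl⟩) hg, rfl⟩

theorem of_mem_closure (hr : ∀ i x, r i (r i x) = x) {g : Equiv.Perm X}
    (hg : g ∈ Subgroup.closure (r '' I)) (x : X) : Linked r I x (g x) := by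
  induction hg using Subgroup.closure_induction generalizing x with
  | mem g hg =>
    obtain ⟨i, hi, rfl⟩ := hg
    exact step hi x
  | one => exact refl x
  | mul a b _ _ iha ihb => exact (ihb x).trans (iha (b x))
  | inv a _ iha =>
    have := iha (a⁻¹ x)
    rw [← Equiv.Perm.mul_apply, mul_inv_cancel, Equiv.Perm.one_apply] at this
    exact this.symm hr

end Linked

/-! ### Connectedness of maniplexes and the path intersection property -/

namespace Maniplex

variable {n : ℕ} (M : Maniplex.{u} n)

theorem linked_univ (x y : M.Flags) : Linked M.r Set.univ x y := by
  obtain ⟨g, hg, rfl⟩ := M.connected x y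
  rw [← Set.image_univ] at hg
  exact Linked.of_mem_closure M.involutive hg x

variable {M}

theorem r_comm_of_far {i j : Fin n} (h : (i : ℕ) + 2 ≤ j ∨ (j : ℕ) + 2 ≤ i) (x : M.Flags) :
    M.r i (M.r j x) = M.r j (M.r i x) := by
  rcases h with h | h
  · exact M.squares i j h x
  · exact (M.squares j i h x).symm

theorem Linked.split_far {I A B : Set (Fin n)} {x y : M.Flags}
    (hc : ∀ a ∈ A, ∀ b ∈ B, (a : ℕ) + 2 ≤ b ∨ (b : ℕ) + 2 ≤ a) (hI : I ⊆ A ∪ B)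
    (h : Linked M.r I x y) : ∃ z, Linked M.r A x z ∧ Linked M.r B z y :=
  h.split (fun a ha b hb x => r_comm_of_far (hc a ha b hb) x) hI

/-- A path avoiding the colour `k - 1` can be rearranged so that the colours above `k - 1` come
first. -/
theorem Linked.split_at {k : ℕ} {x y : M.Flags} (h : Linked M.r {i | (i : ℕ) + 1 ≠ k} x y) :
    ∃ z, Linked M.r {i | k < (i : ℕ) + 1} x z ∧ Linked M.r {i | (i : ℕ) + 1 < k} z y :=
  Linked.split_far (fun a ha b hb => by simp at ha hb; omega)
    (fun i hi => by simp at hi ⊢; omega) h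

variable (M) in
/-- The path intersection property: flags in a common orbit for each of the sets of colours
`{j}ᶜ`, `j ∉ I`, are joined by a path with colours in `I`. -/
def IsPolytopal : Prop :=
  ∀ (I : Set (Fin n)) (x y : M.Flags), (∀ j ∉ I, Linked M.r {j}ᶜ x y) → Linked M.r I x y

/-- The quotient criterion: a maniplex covering a polytopal one is polytopal if the covering is
injective on facets. -/
theorem IsPolytopal.of_cover {M M' : Maniplex.{u} (n + 1)} (hM' : M'.IsPolytopal)
    (f : M.Flags → M'.Flags) (hf : ∀ i x, f (M.r i x) = M'.r i (f x))
    (hinj : ∀ x y, Linked M.r {Fin.last n}ᶜ x y → f x = f y → x = y) : M.IsPolytopal := by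
  -- Without the last colour in `I`, the hypothesis for that colour puts `x` and `y` in one facet.
  -- Lifting an `I`-path from `f x` to `f y` ends at some `z` in the same facet over `f y`, and
  -- injectivity on facets gives `z = y`.
  have key : ∀ (I : Set (Fin (n + 1))) (x y : M.Flags), Fin.last n ∉ I →
      (∀ j ∉ I, Linked M.r {j}ᶜ x y) → Linked M.r I x y := by
    intro I x y hI h
    obtain ⟨z, hz, hzy⟩ := Linked.lift (r := M.r) f (fun i _ => hf i)
      (hM' I (f x) (f y) (fun j hj => (h j hj).map f (fun i _ => hf i)))
    have hlast : I ⊆ {Fin.last n}ᶜ := fun i hi he => hI (he ▸ hi)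
    rwa [hinj z y (((hz.mono hlast).symm M.involutive).trans (h _ hI)) hzy] at hz
  intro I x y h
  by_cases hlast : Fin.last n ∈ I
  swap
  · exact key I x y hlast h
  by_cases hne : (Iᶜ).Nonempty
  swap
  · rw [Set.not_nonempty_iff_eq_empty, Set.compl_empty_iff] at hne
    rw [hne]
    exact M.linked_univ x y
  -- With `j` the largest colour outside `I`, a path avoiding `j` splits into colours above `j`, all
  -- of which lie in `I`, followed by colours below `j`, which avoid the last colour.
  obtain ⟨j, hj, hmax⟩ := (Set.toFinite (Iᶜ)).exists_maximalFor id _ hne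
  have hmax' : ∀ m ∉ I, m ≤ j := fun m hm => by
    by_contra hlt
    exact hlt (hmax hm (le_of_not_ge hlt))
  have hjl : j < Fin.last n := lt_of_le_of_ne (Fin.le_last j) (fun e => hj (e ▸ hlast))
  obtain ⟨v, hxv, hvy⟩ := Linked.split_at (M := M) (k := j + 1)
    ((h j hj).mono (fun i hi => by
      simp only [Set.mem_compl_iff, Set.mem_singleton_iff, Fin.ext_iff] at hi
      simp only [Set.mem_ofPred_eq]; omega))
  have hxvI : Linked M.r I x v := hxv.mono (fun i hi => by
    by_contra hiI
    have := hmax' i hiI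
    simp only [Set.mem_ofPred_eq] at hi
    rw [Fin.le_def] at this
    omega)
  -- From `v` on, the last colour can be dropped from `I`, which is the case already settled.
  refine hxvI.trans ((key (I \ {Fin.last n}) v y (by simp) ?_).mono Set.sdiff_subset)
  intro m hm
  by_cases hml : m = Fin.last n
  · refine hvy.mono (fun i hi => ?_)
    simp only [Set.mem_ofPred_eq] at hi
    rw [Fin.lt_def] at hjl
    simp only [Set.mem_compl_iff, Set.mem_singleton_iff, Fin.ext_iff, hml]
    omega
  · have hmI : m ∉ I := fun hmI => hm ⟨hmI, hml⟩
    refine ((hxvI.mono ?_).symm M.involutive).trans (h m hmI)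
    intro i hi e
    exact hmI (e ▸ hi)

end Maniplex

/-! ### The poset of a maniplex -/

namespace Maniplex

variable {n : ℕ}

/-- A face of height `ht` given by one of its flags. -/
structure PreFace (M : Maniplex.{u} n) : Type u where
  ht : Fin (n + 2)
  flag : M.Flags

/-- A face of height `k` is an orbit under the colours other than `k - 1`; for the heights `0` and
`n + 1` no colour is omitted. Incidence means that the two orbits share a flag `z`. -/
instance (M : Maniplex.{u} n) : Preorder M.PreFace where
  le F G := F.ht ≤ G.ht ∧ ∃ z, Linked M.r {i | (i : ℕ) + 1 ≠ F.ht} F.flag z ∧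
    Linked M.r {i | (i : ℕ) + 1 ≠ G.ht} z G.flag
  le_refl F := ⟨le_rfl, F.flag, Linked.refl _, Linked.refl _⟩
  le_trans := by
    rintro ⟨k, x⟩ ⟨l, y⟩ ⟨m, w⟩ ⟨hkl, a, hxa, hay⟩ ⟨hlm, b, hyb, hbw⟩
    refine ⟨hkl.trans hlm, ?_⟩
    -- In the path from `a` to `b` inside the middle face, the colours above `l - 1` do not leave
    -- the lower face and those below `l - 1` do not leave the upper one. The turning point `z` is
    -- thus a flag of both outer faces.
    obtain ⟨z, haz, hzb⟩ := Linked.split_at (hay.trans hyb)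
    simp only [Fin.le_def] at hkl hlm
    refine ⟨z, hxa.trans (haz.mono ?_), (hzb.mono ?_).trans hbw⟩ <;>
    · intro i hi
      simp only [Set.mem_ofPred_eq] at hi ⊢
      omega

/-- The poset of faces of a maniplex, with a least and a greatest face. -/
def Poset (M : Maniplex.{u} n) : Type u := Antisymmetrization M.PreFace (· ≤ ·)

variable {M : Maniplex.{u} n}

instance : PartialOrder M.Poset :=
  inferInstanceAs (PartialOrder (Antisymmetrization M.PreFace (· ≤ ·)))

variable (M) in
/-- The face of height `k` of a flag. -/
def mkFace (k : Fin (n + 2)) (x : M.Flags) : M.Poset := toAntisymmetrization (· ≤ ·) ⟨k, x⟩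

theorem exists_mkFace (F : M.Poset) : ∃ k x, F = M.mkFace k x := by
  induction F using Antisymmetrization.ind with
  | _ a => exact ⟨a.ht, a.flag, rfl⟩

theorem mkFace_le_mkFace {k l : Fin (n + 2)} {x y : M.Flags} :
    M.mkFace k x ≤ M.mkFace l y ↔ k ≤ l ∧ ∃ z, Linked M.r {i | (i : ℕ) + 1 ≠ k} x z ∧
      Linked M.r {i | (i : ℕ) + 1 ≠ l} z y := Iff.rfl

theorem mkFace_eq_mkFace {k l : Fin (n + 2)} {x y : M.Flags} :
    M.mkFace k x = M.mkFace l y ↔ k = l ∧ Linked M.r {i | (i : ℕ) + 1 ≠ k} x y := by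
  constructor
  · intro h
    obtain ⟨h1, z, h2, h3⟩ := mkFace_le_mkFace.1 h.le
    have h4 := (mkFace_le_mkFace.1 h.ge).1
    obtain rfl := le_antisymm h1 h4
    exact ⟨rfl, h2.trans h3⟩
  · rintro ⟨rfl, h⟩
    exact le_antisymm (mkFace_le_mkFace.2 ⟨le_rfl, x, Linked.refl _, h⟩)
      (mkFace_le_mkFace.2 ⟨le_rfl, y, Linked.refl _, h.symm M.involutive⟩)

theorem mkFace_mono (x : M.Flags) : Monotone (fun k => M.mkFace k x) := fun _ _ h =>
  mkFace_le_mkFace.2 ⟨h, x, Linked.refl _, Linked.refl _⟩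

theorem mkFace_strictMono (x : M.Flags) : StrictMono (fun k => M.mkFace k x) :=
  (mkFace_mono x).strictMono_of_injective fun _ _ h => (mkFace_eq_mkFace.1 h).1

theorem mkFace_le_mkFace_iff_exists {k l : Fin (n + 2)} {x y : M.Flags} :
    M.mkFace k x ≤ M.mkFace l y ↔
      k ≤ l ∧ ∃ z, M.mkFace k z = M.mkFace k x ∧ M.mkFace l z = M.mkFace l y := by
  rw [mkFace_le_mkFace]
  refine and_congr_right fun _ => exists_congr fun z => and_congr ?_ ?_
  · rw [eq_comm, mkFace_eq_mkFace, and_iff_right rfl]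
  · rw [mkFace_eq_mkFace, and_iff_right rfl]

theorem mkFace_eq_of_linked {I : Set (Fin n)} {x y : M.Flags} (h : Linked M.r I x y)
    {k : Fin (n + 2)} (hk : ∀ i ∈ I, (i : ℕ) + 1 ≠ k) : M.mkFace k x = M.mkFace k y :=
  mkFace_eq_mkFace.2 ⟨rfl, h.mono hk⟩

noncomputable instance : BoundedOrder M.Poset where
  bot := M.mkFace 0 (Classical.choice M.nonempty)
  bot_le F := by
    obtain ⟨k, x, rfl⟩ := exists_mkFace F
    exact mkFace_le_mkFace.2 ⟨Fin.zero_le k, x,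
      (M.linked_univ _ _).mono (fun i _ => by simp), Linked.refl _⟩
  top := M.mkFace (Fin.last _) (Classical.choice M.nonempty)
  le_top F := by
    obtain ⟨k, x, rfl⟩ := exists_mkFace F
    exact mkFace_le_mkFace.2 ⟨Fin.le_last k, x, Linked.refl _,
      (M.linked_univ _ _).mono (fun i _ => by simp; omega)⟩

theorem mkFace_zero (x : M.Flags) : M.mkFace 0 x = ⊥ :=
  mkFace_eq_mkFace.2 ⟨rfl, (M.linked_univ _ _).mono (fun i _ => by simp)⟩

/-- The height of a face. -/
noncomputable def Poset.ht (F : M.Poset) : ℕ := (ofAntisymmetrization (· ≤ ·) F : M.PreFace).ht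

theorem ht_mkFace (k : Fin (n + 2)) (x : M.Flags) : (M.mkFace k x).ht = k := by
  set a : M.PreFace := ofAntisymmetrization (· ≤ ·) (M.mkFace k x) with ha
  have h : M.mkFace a.ht a.flag = M.mkFace k x :=
    toAntisymmetrization_ofAntisymmetrization (α := M.PreFace) (· ≤ ·) (M.mkFace k x)
  exact congrArg _ (mkFace_eq_mkFace.1 h).1

theorem ht_strictMono : StrictMono (Poset.ht : M.Poset → ℕ) := by
  intro F G h
  obtain ⟨k, x, rfl⟩ := exists_mkFace F
  obtain ⟨l, y, rfl⟩ := exists_mkFace G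
  rw [ht_mkFace, ht_mkFace]
  obtain ⟨hkl, z, hz1, hz2⟩ := mkFace_le_mkFace_iff_exists.1 h.le
  refine lt_of_le_of_ne hkl fun e => h.ne ?_
  obtain rfl := Fin.ext e
  rw [← hz1, hz2]

/-- The strictly monotone `Poset.ht` bounds the height above; the chain of faces of `x` bounds it
below. -/
theorem height_mkFace (k : Fin (n + 2)) (x : M.Flags) : Order.height (M.mkFace k x) = (k : ℕ) := by
  apply le_antisymm
  · have := Order.height_le_height_apply_of_strictMono _ ht_strictMono (M.mkFace k x)
    rwa [Order.height_nat, ht_mkFace] at this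
  · induction k using Fin.induction with
    | zero => simp
    | succ k ih =>
      have := Order.height_add_one_le (mkFace_strictMono x (Fin.castSucc_lt_succ (i := k)))
      refine le_trans ?_ this
      simpa using ih

theorem faceRank_mkFace (k : Fin (n + 2)) (x : M.Flags) : faceRank (M.mkFace k x) = (k : ℤ) - 1 := by
  rw [faceRank, height_mkFace]
  simp

/-- The chain of all faces of a flag of the maniplex. -/
def flagOf (x : M.Flags) : Flag M.Poset where
  carrier := Set.range (fun k => M.mkFace k x)
  Chain' := (mkFace_mono x).isChain_range
  max_chain' := by
    intro s hs hsub
    refine hsub.antisymm ?_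
    intro F hF
    obtain ⟨k, y, rfl⟩ := exists_mkFace F
    have hkx : M.mkFace k x ∈ s := hsub ⟨k, rfl⟩
    -- Comparable faces of equal height share a flag, hence coincide.
    have : M.mkFace k y = M.mkFace k x := by
      rcases hs.total hF hkx with h | h
      · obtain ⟨_, z, h1, h2⟩ := mkFace_le_mkFace_iff_exists.1 h
        rw [← h1, h2]
      · obtain ⟨_, z, h1, h2⟩ := mkFace_le_mkFace_iff_exists.1 h
        rw [← h1, h2]
    exact ⟨k, this.symm⟩

theorem mem_flagOf {F : M.Poset} {x : M.Flags} : F ∈ flagOf x ↔ ∃ k, M.mkFace k x = F := Iff.rfl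

theorem mkFace_mem_flagOf {k : Fin (n + 2)} {x y : M.Flags} :
    M.mkFace k x ∈ flagOf y ↔ M.mkFace k x = M.mkFace k y := by
  rw [mem_flagOf]
  constructor
  · rintro ⟨l, h⟩
    obtain rfl := (mkFace_eq_mkFace.1 h).1
    exact h.symm
  · exact fun h => ⟨k, h.symm⟩

theorem ncard_flagOf (x : M.Flags) : ((flagOf x : Flag M.Poset) : Set M.Poset).ncard = n + 2 := by
  have : ((flagOf x : Flag M.Poset) : Set M.Poset) = (fun k => M.mkFace k x) '' Set.univ :=
    Set.image_univ.symm
  rw [this, Set.ncard_image_of_injective _ (mkFace_strictMono x).injective, Set.ncard_univ,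
    Nat.card_eq_fintype_card, Fintype.card_fin]

/-- Every flag of the poset consists of the faces of a flag of the maniplex. -/
theorem flagOf_surjective : Function.Surjective (flagOf : M.Flags → Flag M.Poset) := by
  intro Ψ
  -- Induction on the height: `x` is a flag through all the faces of `Ψ` of height at most `m`, and
  -- `l` is the largest height among these. No absence of gaps is assumed; at the end `Ψ` is
  -- contained in `flagOf x` and maximality gives equality.
  have key : ∀ m : ℕ, ∃ (l : Fin (n + 2)) (x : M.Flags), (l : ℕ) ≤ m ∧ M.mkFace l x ∈ Ψ ∧
      ∀ F ∈ Ψ, F.ht ≤ m → F.ht ≤ l ∧ F ∈ flagOf x := by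
    intro m
    induction m with
    | zero =>
      have x := Classical.choice M.nonempty
      refine ⟨0, x, le_rfl, by rw [mkFace_zero]; exact Ψ.bot_mem, fun F _ hF => ⟨hF, ?_⟩⟩
      obtain ⟨k, y, rfl⟩ := exists_mkFace F
      rw [ht_mkFace] at hF
      obtain rfl : k = 0 := Fin.ext (by simpa using hF)
      rw [mkFace_zero]
      exact Flag.bot_mem _
    | succ m ih =>
      obtain ⟨l, x, hl, hlΨ, hx⟩ := ih
      by_cases hm : ∃ F ∈ Ψ, F.ht = m + 1
      swap
      · push Not at hm
        exact ⟨l, x, hl.trans (Nat.le_succ m), hlΨ, fun F hF hFm =>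
          hx F hF (Nat.le_of_lt_succ (lt_of_le_of_ne hFm (hm F hF)))⟩
      obtain ⟨F, hF, hFm⟩ := hm
      obtain ⟨k, y, rfl⟩ := exists_mkFace F
      rw [ht_mkFace] at hFm
      have hle : M.mkFace l x ≤ M.mkFace k y := by
        rcases Ψ.le_or_le hlΨ hF with h | h
        · exact h
        · have := (mkFace_le_mkFace.1 h).1
          rw [Fin.le_def] at this
          omega
      obtain ⟨_, w, hw1, hw2⟩ := mkFace_le_mkFace_iff_exists.1 hle
      -- Passing from `x` to `z` uses only colours above `l - 1`, so the faces of height at most `l`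
      -- are kept; passing from `z` to `w` uses only colours below `l - 1`, so `z` already has the
      -- new face.
      obtain ⟨z, hxz, hzw⟩ := Linked.split_at (mkFace_eq_mkFace.1 hw1.symm).2
      have hzk : M.mkFace k z = M.mkFace k y := by
        rw [← hw2]
        exact mkFace_eq_of_linked hzw (fun i hi => by simp only [Set.mem_ofPred_eq] at hi; omega)
      refine ⟨k, z, hFm.le, hzk ▸ hF, fun G hG hGm => ?_⟩
      refine ⟨hFm ▸ hGm, ?_⟩
      rcases Nat.le_succ_iff.1 hGm with hGm | hGm
      · obtain ⟨hGl, j, rfl⟩ := hx G hG hGm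
        rw [ht_mkFace] at hGl
        rw [mkFace_mem_flagOf]
        exact mkFace_eq_of_linked hxz (fun i hi => by simp only [Set.mem_ofPred_eq] at hi; omega)
      · obtain ⟨j, v, rfl⟩ := exists_mkFace G
        rw [ht_mkFace] at hGm
        obtain rfl : j = k := Fin.ext (by omega)
        have : M.mkFace j v = M.mkFace j y := by
          rcases Ψ.le_or_le hG hF with h | h
          · obtain ⟨_, z, h1, h2⟩ := mkFace_le_mkFace_iff_exists.1 h
            rw [← h1, h2]
          · obtain ⟨_, z, h1, h2⟩ := mkFace_le_mkFace_iff_exists.1 h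
            rw [← h1, h2]
        rw [mkFace_mem_flagOf, this, hzk]
  obtain ⟨l, x, _, _, hx⟩ := key (n + 1)
  refine ⟨x, Flag.ext (Ψ.maxChain.2 (flagOf x).chain_le ?_).symm⟩
  intro F hF
  refine (hx F hF ?_).2
  obtain ⟨k, y, rfl⟩ := exists_mkFace F
  rw [ht_mkFace]
  omega

theorem exists_flagOf {F G : M.Poset} (h : F ≤ G) : ∃ x, F ∈ flagOf x ∧ G ∈ flagOf x := by
  obtain ⟨Ψ, h1, h2⟩ := Flag.exists_mem_mem h
  obtain ⟨x, rfl⟩ := flagOf_surjective Ψ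
  exact ⟨x, h1, h2⟩

theorem eq_mkFace_of_mem {F : M.Poset} {x : M.Flags} {i : ℤ} (h : F ∈ flagOf x)
    (hF : faceRank F = i) {k : Fin (n + 2)} (hk : (k : ℤ) = i + 1) : F = M.mkFace k x := by
  obtain ⟨l, rfl⟩ := h
  simp only [faceRank_mkFace] at hF
  obtain rfl : l = k := Fin.ext (by omega)
  rfl

/-! ### Polytopes from polytopal maniplexes -/

namespace IsPolytopal

variable (hM : M.IsPolytopal)
include hM

/-- The path intersection property in terms of faces. The index `j.succ.castSucc` has height `j +
1`, that is rank `j`, so sharing that face means being joined without the colour `j`. -/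
theorem linked {I : Set (Fin n)} {x y : M.Flags}
    (h : ∀ j : Fin n, j ∉ I → M.mkFace j.succ.castSucc x = M.mkFace j.succ.castSucc y) :
    Linked M.r I x y := by
  refine hM I x y fun j hj => (mkFace_eq_mkFace.1 (h j hj)).2.mono fun i hi => ?_
  rintro rfl
  simp at hi

theorem flagOf_injective : Function.Injective (flagOf : M.Flags → Flag M.Poset) := by
  intro x y h
  refine (Linked.eq_of_empty (hM.linked (I := ∅) fun j _ => ?_)).symm
  rw [← mkFace_mem_flagOf, ← h]
  exact ⟨_, rfl⟩

theorem flagAdj_iff {i : Fin n} {x y : M.Flags} :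
    FlagAdj ((i : ℕ) : ℤ) (flagOf x) (flagOf y) ↔ y = M.r i x := by
  constructor
  · rintro ⟨hne, h⟩
    have h1 : Linked M.r {i} x y := by
      refine hM.linked fun j hj => ?_
      rw [← mkFace_mem_flagOf, ← h]
      · exact ⟨_, rfl⟩
      · rw [faceRank_mkFace]
        intro e
        exact hj (Fin.ext (by simp at e; omega))
    have h2 := Linked.eq_or_eq_of_singleton M.involutive h1
    rcases h2 with rfl | h2
    · exact absurd rfl hne
    · exact h2
  · rintro rfl
    refine ⟨fun e => M.fixed_point_free i x (hM.flagOf_injective e).symm, fun F hF => ?_⟩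
    obtain ⟨k, z, rfl⟩ := exists_mkFace F
    rw [faceRank_mkFace] at hF
    rw [mkFace_mem_flagOf, mkFace_mem_flagOf,
      mkFace_eq_of_linked (Linked.step (r := M.r) (Set.mem_singleton i) x)]
    intro j hj
    rw [Set.mem_singleton_iff.1 hj]
    omega

/-- The poset of a polytopal maniplex is a polytope. -/
theorem isPolytope : IsPolytope n M.Poset where
  flag_card Φ := by
    obtain ⟨x, rfl⟩ := flagOf_surjective Φ
    exact ncard_flagOf x
  diamond i hi F H hF hH hFH := by
    obtain ⟨x, hFx, hHx⟩ := exists_flagOf hFH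
    have hi0 : i < n + 2 := Nat.lt_add_right 2 hi
    have hi1 : i + 1 < n + 2 := by omega
    have hi2 : i + 2 < n + 2 := Nat.add_lt_add_right hi 2
    obtain rfl := eq_mkFace_of_mem hFx hF (k := ⟨i, hi0⟩) (by simp)
    obtain rfl := eq_mkFace_of_mem hHx hH (k := ⟨i + 2, hi2⟩) (by simp; ring)
    have hne : M.mkFace ⟨i + 1, hi1⟩ x ≠ M.mkFace ⟨i + 1, hi1⟩ (M.r ⟨i, hi⟩ x) := by
      intro e
      apply M.fixed_point_free ⟨i, hi⟩ x
      refine Linked.eq_of_empty (hM.linked (I := ∅) fun j _ => ?_)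
      by_cases hj : (j : ℕ) = i
      · have : j.succ.castSucc = ⟨i + 1, hi1⟩ := Fin.ext (by simp [hj])
        rw [this]
        exact e
      · refine mkFace_eq_of_linked (Linked.step (r := M.r) (Set.mem_singleton ⟨i, hi⟩) x) ?_
        intro m hm
        rw [Set.mem_singleton_iff.1 hm]
        simp
        omega
    refine (congrArg Set.ncard ?_).trans (Set.ncard_pair hne)
    ext G
    simp only [Set.mem_ofPred_eq, Set.mem_insert_iff, Set.mem_singleton_iff]
    have hlinkr : ∀ k : Fin (n + 2), (k : ℕ) ≠ i + 1 →
        M.mkFace k x = M.mkFace k (M.r ⟨i, hi⟩ x) := fun k hk =>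
      mkFace_eq_of_linked (Linked.step (r := M.r) (Set.mem_singleton ⟨i, hi⟩) x) (by
        intro m hm
        rw [Set.mem_singleton_iff.1 hm]
        exact fun e => hk e.symm)
    constructor
    · rintro ⟨h1, h2⟩
      have hc : IsChain (· ≤ ·) ({M.mkFace ⟨i, hi0⟩ x, G, M.mkFace ⟨i + 2, hi2⟩ x} :
          Set M.Poset) := by
        refine IsChain.insert ?_ ?_
        · exact IsChain.pair h2.le
        · rintro b (rfl | rfl) _
          · exact Or.inl h1.le
          · exact Or.inl hFH
      obtain ⟨Ψ, hΨ⟩ := hc.exists_subset_flag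
      obtain ⟨y, rfl⟩ := flagOf_surjective Ψ
      have e1 := mkFace_mem_flagOf.1 (hΨ (Set.mem_insert _ _))
      have e2 := mkFace_mem_flagOf.1
        (hΨ (Set.mem_insert_of_mem _ (Set.mem_insert_of_mem _ (Set.mem_singleton _))))
      obtain ⟨k, rfl⟩ := mem_flagOf.1 (hΨ (Set.mem_insert_of_mem _ (Set.mem_insert _ _)))
      have l1 := ht_strictMono h1
      have l2 := ht_strictMono h2
      simp only [ht_mkFace] at l1 l2
      obtain rfl : k = ⟨i + 1, hi1⟩ := Fin.ext (by simp; omega)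
      -- The flags `x` and `y` share the faces of ranks `i - 1` and `i + 1`, so neither of these
      -- colours is needed. The colour `i` commutes with all the remaining ones, and can be used up
      -- first: `z` is `x` or its `i`-neighbour, and the rest of the path keeps the face of rank
      -- `i`.
      have hxy : Linked M.r {j | (j : ℕ) + 1 ≠ i ∧ (j : ℕ) ≠ i + 1} x y := by
        refine hM.linked fun j hj => ?_
        simp only [Set.mem_ofPred_eq, not_and_or, not_not] at hj
        rcases hj with hj | hj
        · have : j.succ.castSucc = ⟨i, hi0⟩ := Fin.ext (by simp [hj])
          rw [this, e1]
        · have : j.succ.castSucc = ⟨i + 2, hi2⟩ := Fin.ext (by simp [hj])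
          rw [this, e2]
      obtain ⟨z, hxz, hzy⟩ := Linked.split_far (A := {⟨i, hi⟩})
        (B := {j | (j : ℕ) + 2 ≤ i ∨ i + 2 ≤ (j : ℕ)})
        (fun a ha b hb => by
          simp only [Set.mem_singleton_iff, Set.mem_ofPred_eq] at ha hb
          rw [ha]
          simp only
          omega)
        (fun j hj => by
          simp only [Set.mem_union, Set.mem_singleton_iff, Set.mem_ofPred_eq, Fin.ext_iff] at hj ⊢
          omega) hxy
      have hz := Linked.eq_or_eq_of_singleton M.involutive hxz
      have hzy' : M.mkFace ⟨i + 1, hi1⟩ z = M.mkFace ⟨i + 1, hi1⟩ y :=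
        mkFace_eq_of_linked hzy (fun j hj => by
          simp only [Set.mem_ofPred_eq] at hj ⊢
          omega)
      rcases hz with rfl | rfl
      · exact Or.inl hzy'.symm
      · exact Or.inr hzy'.symm
    · have lt1 : ∀ y, M.mkFace ⟨i, hi0⟩ y < M.mkFace ⟨i + 1, hi1⟩ y := fun y =>
        mkFace_strictMono y (by simp [Fin.lt_def])
      have lt2 : ∀ y, M.mkFace ⟨i + 1, hi1⟩ y < M.mkFace ⟨i + 2, hi2⟩ y := fun y =>
        mkFace_strictMono y (by simp [Fin.lt_def])
      rintro (rfl | rfl)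
      · exact ⟨lt1 x, lt2 x⟩
      · rw [hlinkr ⟨i, hi0⟩ (by simp), hlinkr ⟨i + 2, hi2⟩ (by simp)]
        exact ⟨lt1 _, lt2 _⟩
  strongly_flag_connected Φ Ψ := by
    obtain ⟨x, rfl⟩ := flagOf_surjective Φ
    obtain ⟨y, rfl⟩ := flagOf_surjective Ψ
    -- Only the colours of the ranks in which the two flags differ are used, so each common face
    -- persists along the path.
    set I : Set (Fin n) := {j | M.mkFace j.succ.castSucc x ≠ M.mkFace j.succ.castSucc y} with hI
    have h : Linked M.r I x y := hM.linked fun j hj => not_not.1 hj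
    have hsub : ∀ z, Linked M.r I x z →
        ((flagOf x : Flag M.Poset) : Set M.Poset) ∩ (flagOf y : Flag M.Poset) ⊆
          (flagOf z : Flag M.Poset) := by
      rintro z hz F ⟨⟨k, rfl⟩, hF⟩
      have hF' := mkFace_mem_flagOf.1 hF
      refine mkFace_mem_flagOf.2 (mkFace_eq_of_linked hz fun i hi e => hi ?_)
      obtain rfl : k = i.succ.castSucc := Fin.ext (by simp [e])
      exact hF'
    have hgen : ∀ z, Linked M.r I x z → Relation.ReflTransGen
        (fun A B : Flag M.Poset => (∃ i : ℤ, FlagAdj i A B) ∧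
          ((flagOf x : Flag M.Poset) : Set M.Poset) ∩ (flagOf y : Flag M.Poset) ⊆ B)
        (flagOf x) (flagOf z) := by
      intro z hz
      induction hz with
      | refl => exact Relation.ReflTransGen.refl
      | tail hxb hs ih =>
        refine ih.tail ?_
        obtain ⟨i, hi, rfl⟩ := hs
        exact ⟨⟨_, hM.flagAdj_iff.2 rfl⟩, hsub _ (Linked.tail hxb hi)⟩
    exact hgen y h

end IsPolytopal

end Maniplex

/-! ### The flag graph of a polytope -/

theorem faceRank_orderIso {α β : Type u} [PartialOrder α] [PartialOrder β] (e : α ≃o β) (F : α) :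
    faceRank (e F) = faceRank F := by
  rw [faceRank, faceRank, Order.height_orderIso]

theorem Flag.eq_of_subset {α : Type*} [PartialOrder α] {Φ Ψ : Flag α}
    (h : ∀ F ∈ Φ, F ∈ Ψ) : Φ = Ψ :=
  Flag.ext (Φ.maxChain.2 Ψ.chain_le h)

theorem FlagAdj.symm {α : Type u} [PartialOrder α] {i : ℤ} {Φ Ψ : Flag α} (h : FlagAdj i Φ Ψ) :
    FlagAdj i Ψ Φ :=
  ⟨h.1.symm, fun F hF => (h.2 F hF).symm⟩

theorem FlagAdj.map {α β : Type u} [PartialOrder α] [PartialOrder β] {i : ℤ} {Φ Ψ : Flag α}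
    (h : FlagAdj i Φ Ψ) (e : α ≃o β) : FlagAdj i (Flag.map e Φ) (Flag.map e Ψ) := by
  refine ⟨fun he => h.1 ((Flag.map e).injective he), fun F hF => ?_⟩
  have hmem : ∀ Ω : Flag α, F ∈ Flag.map e Ω ↔ e.symm F ∈ Ω := fun Ω => by
    rw [← Flag.mem_coe_iff, Flag.coe_map]
    constructor
    · rintro ⟨G, hG, rfl⟩
      simpa using hG
    · exact fun hG => ⟨_, hG, by simp⟩
  rw [hmem, hmem]
  exact h.2 _ (by rwa [faceRank_orderIso])

namespace IsPolytope

variable {N : ℕ} {α : Type u} [PartialOrder α] [BoundedOrder α] (h : IsPolytope N α)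
include h

theorem flag_finite (Φ : Flag α) : (Φ : Set α).Finite :=
  Set.finite_of_ncard_ne_zero (by rw [h.flag_card Φ]; omega)

theorem height_le (F : α) : Order.height F ≤ (N + 1 : ℕ) := by
  refine Order.height_le fun p _ => ?_
  obtain ⟨Φ, hΦ⟩ := p.strictMono.monotone.isChain_range.exists_subset_flag
  have h1 := Set.ncard_le_ncard hΦ (h.flag_finite Φ)
  rw [h.flag_card, ← Set.image_univ, Set.ncard_image_of_injective _ p.strictMono.injective,
    Set.ncard_univ, Nat.card_eq_fintype_card, Fintype.card_fin] at h1
  exact_mod_cast (by omega : p.length ≤ N + 1)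

theorem faceRank_strictMono : StrictMono (faceRank : α → ℤ) := by
  intro F G hFG
  have hfin : ∀ F : α, Order.height F ≠ ⊤ := fun F =>
    ne_top_of_le_ne_top (ENat.natCast_ne_top _) (h.height_le F)
  have := Order.height_strictMono hFG (lt_top_iff_ne_top.2 (hfin F))
  rw [← ENat.natCast_toNat (hfin F), ← ENat.natCast_toNat (hfin G), Nat.cast_lt] at this
  simp only [faceRank]
  omega

theorem faceRank_eq (F : α) : ∃ k : Fin (N + 2), faceRank F = (k : ℤ) - 1 := by
  have := ENat.toNat_le_of_le_natCast (h.height_le F)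
  exact ⟨⟨(Order.height F).toNat, by omega⟩, rfl⟩

theorem eq_of_mem {Φ : Flag α} {F G : α} (hF : F ∈ Φ) (hG : G ∈ Φ)
    (hFG : faceRank F = faceRank G) : F = G := by
  rcases Φ.le_or_le hF hG with hle | hle
  · exact hle.eq_or_lt.resolve_right fun hlt => (h.faceRank_strictMono hlt).ne hFG
  · exact (hle.eq_or_lt.resolve_right fun hlt => (h.faceRank_strictMono hlt).ne hFG.symm).symm

/-- Pigeonhole: the rank is injective on a flag, which has `N + 2` elements, and takes at most `N +
2` values. -/
theorem exists_face (Φ : Flag α) (k : Fin (N + 2)) : ∃ F ∈ Φ, faceRank F = (k : ℤ) - 1 := by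
  choose g hg using h.faceRank_eq
  have hinj : Set.InjOn g (Φ : Set α) := fun F hF G hG e =>
    h.eq_of_mem hF hG (by rw [hg, hg, e])
  have himg : g '' (Φ : Set α) = Set.univ := by
    apply Set.eq_of_subset_of_ncard_le (Set.subset_univ _)
    rw [hinj.ncard_image, h.flag_card, Set.ncard_univ, Nat.card_eq_fintype_card,
      Fintype.card_fin]
  obtain ⟨F, hF, rfl⟩ := himg.ge (Set.mem_univ k)
  exact ⟨F, hF, hg F⟩

/-- The face of rank `k - 1` of a flag. -/
noncomputable def face (Φ : Flag α) (k : Fin (N + 2)) : α := (h.exists_face Φ k).choose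

theorem face_mem (Φ : Flag α) (k : Fin (N + 2)) : h.face Φ k ∈ Φ :=
  (h.exists_face Φ k).choose_spec.1

theorem faceRank_face (Φ : Flag α) (k : Fin (N + 2)) : faceRank (h.face Φ k) = (k : ℤ) - 1 :=
  (h.exists_face Φ k).choose_spec.2

theorem eq_face {Φ : Flag α} {F : α} (hF : F ∈ Φ) {k : Fin (N + 2)}
    (hk : faceRank F = (k : ℤ) - 1) : F = h.face Φ k :=
  h.eq_of_mem hF (h.face_mem Φ k) (hk.trans (h.faceRank_face Φ k).symm)

theorem face_mem_iff {Φ Ψ : Flag α} {k : Fin (N + 2)} :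
    h.face Φ k ∈ Ψ ↔ h.face Φ k = h.face Ψ k :=
  ⟨fun hm => h.eq_face hm (h.faceRank_face Φ k), fun e => e ▸ h.face_mem Ψ k⟩

theorem exists_eq_face {Φ : Flag α} {F : α} (hF : F ∈ Φ) :
    ∃ k : Fin (N + 2), F = h.face Φ k ∧ faceRank F = (k : ℤ) - 1 := by
  obtain ⟨k, hk⟩ := h.faceRank_eq F
  exact ⟨k, h.eq_face hF hk, hk⟩

theorem face_strictMono (Φ : Flag α) : StrictMono (h.face Φ) := by
  intro k l hkl
  have hr : faceRank (h.face Φ k) < faceRank (h.face Φ l) := by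
    rw [h.faceRank_face, h.faceRank_face]
    rw [Fin.lt_def] at hkl
    omega
  rcases Φ.le_or_le (h.face_mem Φ k) (h.face_mem Φ l) with hle | hle
  · exact lt_of_le_of_ne hle fun e => hr.ne (by rw [e])
  · exact absurd (h.faceRank_strictMono.monotone hle) (not_le.2 hr)

theorem face_le_iff {Φ : Flag α} {k l : Fin (N + 2)} : h.face Φ k ≤ h.face Φ l ↔ k ≤ l :=
  (h.face_strictMono Φ).le_iff_le

theorem flag_ext {Φ Ψ : Flag α} (hk : ∀ k, h.face Φ k = h.face Ψ k) : Φ = Ψ := by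
  refine Flag.eq_of_subset fun F hF => ?_
  obtain ⟨k, rfl, _⟩ := h.exists_eq_face hF
  exact h.face_mem_iff.2 (hk k)

theorem face_zero (Φ : Flag α) : h.face Φ 0 = ⊥ :=
  (h.eq_face Φ.bot_mem (by simp [faceRank])).symm

theorem face_last (Φ : Flag α) : h.face Φ (Fin.last _) = ⊤ := by
  obtain ⟨k, hk, _⟩ := h.exists_eq_face Φ.top_mem
  exact le_antisymm le_top (hk ▸ h.face_le_iff.2 (Fin.le_last k))

theorem flagAdj_iff_face {i : Fin N} {Φ Ψ : Flag α} : FlagAdj ((i : ℕ) : ℤ) Φ Ψ ↔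
    (∀ k : Fin (N + 2), (k : ℕ) ≠ i + 1 → h.face Φ k = h.face Ψ k) ∧
      h.face Φ i.succ.castSucc ≠ h.face Ψ i.succ.castSucc := by
  constructor
  · rintro ⟨hne, hiff⟩
    have h1 : ∀ k : Fin (N + 2), (k : ℕ) ≠ i + 1 → h.face Φ k = h.face Ψ k := by
      intro k hk
      rw [← h.face_mem_iff, ← hiff]
      · exact h.face_mem Φ k
      · rw [h.faceRank_face]
        omega
    refine ⟨h1, fun e => hne (h.flag_ext fun k => ?_)⟩
    by_cases hk : (k : ℕ) = i + 1
    · obtain rfl : k = i.succ.castSucc := Fin.ext (by simp [hk])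
      exact e
    · exact h1 k hk
  · rintro ⟨h1, h2⟩
    refine ⟨fun e => h2 (by rw [e]), fun F hF => ?_⟩
    constructor <;>
    · intro hm
      obtain ⟨k, rfl, hk⟩ := h.exists_eq_face hm
      rw [hk] at hF
      have := h1 k (by omega)
      rw [h.face_mem_iff, this]

/-- The improper faces lie in every flag, so flags can only differ in the ranks `0, …, N - 1`. -/
theorem exists_of_flagAdj {i : ℤ} {Φ Ψ : Flag α} (hadj : FlagAdj i Φ Ψ) :
    ∃ j : Fin N, i = (j : ℕ) := by
  by_contra hi
  push Not at hi
  refine hadj.1 (h.flag_ext fun k => ?_)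
  by_cases hk0 : k = 0
  · rw [hk0, h.face_zero, h.face_zero]
  by_cases hkl : k = Fin.last _
  · rw [hkl, h.face_last, h.face_last]
  have hk1 : (k : ℕ) ≠ 0 := fun e => hk0 (Fin.ext e)
  have hk2 : (k : ℕ) ≠ N + 1 := fun e => hkl (Fin.ext e)
  rw [← h.face_mem_iff, ← hadj.2]
  · exact h.face_mem Φ k
  · rw [h.faceRank_face]
    have := hi ⟨k - 1, by omega⟩
    simp only at this
    omega

theorem exists_flag_of_chain {c : Set α} (hc : IsChain (· ≤ ·) c) (hcard : c.ncard = N + 2) :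
    ∃ Φ : Flag α, (Φ : Set α) = c := by
  obtain ⟨Φ, hΦ⟩ := hc.exists_subset_flag
  refine ⟨Φ, (Set.eq_of_subset_of_ncard_le hΦ ?_ (h.flag_finite Φ)).symm⟩
  rw [h.flag_card, hcard]

theorem face_diamond (Φ : Flag α) (i : Fin N) :
    {G | h.face Φ i.castSucc.castSucc < G ∧ G < h.face Φ i.succ.succ}.ncard = 2 :=
  h.diamond i i.2 _ _ (by rw [h.faceRank_face]; simp) (by rw [h.faceRank_face]; simp)
    (h.face_le_iff.2 (by simp [Fin.le_def]; omega))

theorem face_between (Φ : Flag α) (i : Fin N) : h.face Φ i.castSucc.castSucc < h.face Φ i.succ.castSucc ∧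
    h.face Φ i.succ.castSucc < h.face Φ i.succ.succ :=
  ⟨h.face_strictMono Φ (by simp [Fin.lt_def]), h.face_strictMono Φ (by simp [Fin.lt_def])⟩

/-- The face of rank `i` is exchanged for the other element of its diamond. The result is a chain
with `N + 2` elements, hence maximal. -/
theorem exists_flagAdj (i : Fin N) (Φ : Flag α) : ∃ Ψ, FlagAdj ((i : ℕ) : ℤ) Φ Ψ := by
  obtain ⟨G, ⟨hG1, hG2⟩, hGne⟩ := Set.exists_ne_of_one_lt_ncard
    (by rw [h.face_diamond Φ i]; norm_num) (h.face Φ i.succ.castSucc)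
  have hGrank : faceRank G = (i : ℕ) := by
    have h1 := h.faceRank_strictMono hG1
    have h2 := h.faceRank_strictMono hG2
    rw [h.faceRank_face] at h1 h2
    simp at h1 h2
    omega
  have hGΦ : G ∉ Φ := fun hG => hGne (h.eq_face hG (by rw [hGrank]; simp))
  have hchain : IsChain (· ≤ ·) (insert G ((Φ : Set α) \ {h.face Φ i.succ.castSucc})) := by
    refine (Φ.chain_le.mono Set.sdiff_subset).insert fun A hA _ => ?_
    obtain ⟨hA, hAne⟩ := hA
    obtain ⟨k, rfl, hk⟩ := h.exists_eq_face hA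
    have hki : (k : ℕ) ≠ i + 1 := by
      intro e
      obtain rfl : k = i.succ.castSucc := Fin.ext (by simp [e])
      exact hAne rfl
    rcases lt_or_gt_of_ne hki with hlt | hgt
    · exact Or.inr ((h.face_le_iff.2 (by simp [Fin.le_def]; omega)).trans hG1.le)
    · exact Or.inl (hG2.le.trans (h.face_le_iff.2 (by simp [Fin.le_def]; omega)))
  obtain ⟨Ψ, hΨ⟩ := h.exists_flag_of_chain hchain (by
    rw [Set.ncard_insert_of_notMem (fun hm => hGΦ hm.1) ((h.flag_finite Φ).subset Set.sdiff_subset),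
      Set.ncard_sdiff_singleton_add_one (h.face_mem Φ _) (h.flag_finite Φ), h.flag_card])
  have hmem : ∀ A, A ∈ Ψ ↔ A = G ∨ A ∈ Φ ∧ A ≠ h.face Φ i.succ.castSucc := fun A => by
    rw [← Flag.mem_coe_iff, hΨ]
    rfl
  refine ⟨Ψ, fun e => hGΦ (e ▸ (hmem G).2 (Or.inl rfl)), fun A hA => ?_⟩
  rw [hmem]
  constructor
  · intro hm
    refine Or.inr ⟨hm, fun e => hA ?_⟩
    rw [e, h.faceRank_face]
    simp
  · rintro (rfl | hm)
    · exact absurd hGrank hA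
    · exact hm.1

/-- The `i`-face of the `i`-adjacent flag depends only on the faces of ranks `i - 1`, `i` and
`i + 1`. -/
theorem face_eq_of_flagAdj {i : Fin N} {Φ Φ' Ψ Ψ' : Flag α} (hΦ : FlagAdj ((i : ℕ) : ℤ) Φ Φ')
    (hΨ : FlagAdj ((i : ℕ) : ℤ) Ψ Ψ')
    (hk : ∀ k : Fin (N + 2), (i : ℕ) ≤ k → (k : ℕ) ≤ i + 2 → h.face Φ k = h.face Ψ k) :
    h.face Φ' i.succ.castSucc = h.face Ψ' i.succ.castSucc := by
  rw [h.flagAdj_iff_face] at hΦ hΨ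
  -- The common middle face and the two new ones all lie in one two-element set, and both new ones
  -- differ from the middle one.
  obtain ⟨A, B, _, hAB⟩ := Set.ncard_eq_two.1 (h.face_diamond Φ i)
  have hlow : h.face Φ i.castSucc.castSucc = h.face Ψ i.castSucc.castSucc :=
    hk _ (by simp) (by simp)
  have hhigh : h.face Φ i.succ.succ = h.face Ψ i.succ.succ := hk _ (by simp; omega) (by simp)
  have hmid : h.face Φ i.succ.castSucc = h.face Ψ i.succ.castSucc := hk _ (by simp) (by simp)
  have m1 := hAB.le (h.face_between Φ i)
  have m2 : h.face Φ' i.succ.castSucc ∈ ({A, B} : Set α) := hAB.le (by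
    rw [Set.mem_ofPred_eq, hΦ.1 _ (by simp), hΦ.1 i.succ.succ (by simp)]
    exact h.face_between Φ' i)
  have m3 : h.face Ψ' i.succ.castSucc ∈ ({A, B} : Set α) := hAB.le (by
    rw [Set.mem_ofPred_eq, hlow, hhigh, hΨ.1 _ (by simp), hΨ.1 i.succ.succ (by simp)]
    exact h.face_between Ψ' i)
  have n1 := hΦ.2
  have n2 := hΨ.2
  rw [← hmid] at n2
  simp only [Set.mem_insert_iff, Set.mem_singleton_iff] at m1 m2 m3
  grind

theorem flagAdj_unique {i : Fin N} {Φ Ψ Ψ' : Flag α} (h1 : FlagAdj ((i : ℕ) : ℤ) Φ Ψ)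
    (h2 : FlagAdj ((i : ℕ) : ℤ) Φ Ψ') : Ψ = Ψ' := by
  refine h.flag_ext fun k => ?_
  by_cases hk : (k : ℕ) = i + 1
  · obtain rfl : k = i.succ.castSucc := Fin.ext (by simp [hk])
    exact h.face_eq_of_flagAdj h1 h2 fun _ _ _ => rfl
  · rw [← (h.flagAdj_iff_face.1 h1).1 k hk, (h.flagAdj_iff_face.1 h2).1 k hk]

/-- The `i`-adjacent flag. -/
noncomputable def adj (i : Fin N) (Φ : Flag α) : Flag α := (h.exists_flagAdj i Φ).choose

theorem flagAdj_iff {i : Fin N} {Φ Ψ : Flag α} : FlagAdj ((i : ℕ) : ℤ) Φ Ψ ↔ Ψ = h.adj i Φ :=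
  ⟨fun h1 => h.flagAdj_unique h1 (h.exists_flagAdj i Φ).choose_spec,
    fun e => e ▸ (h.exists_flagAdj i Φ).choose_spec⟩

theorem flagAdj_adj (i : Fin N) (Φ : Flag α) : FlagAdj ((i : ℕ) : ℤ) Φ (h.adj i Φ) :=
  h.flagAdj_iff.2 rfl

theorem adj_adj (i : Fin N) (Φ : Flag α) : h.adj i (h.adj i Φ) = Φ :=
  (h.flagAdj_iff.1 (h.flagAdj_adj i Φ).symm).symm

theorem face_adj {i : Fin N} {Φ : Flag α} {k : Fin (N + 2)} (hk : (k : ℕ) ≠ i + 1) :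
    h.face (h.adj i Φ) k = h.face Φ k :=
  ((h.flagAdj_iff_face.1 (h.flagAdj_adj i Φ)).1 k hk).symm

theorem face_adj_ne (i : Fin N) (Φ : Flag α) :
    h.face Φ i.succ.castSucc ≠ h.face (h.adj i Φ) i.succ.castSucc :=
  (h.flagAdj_iff_face.1 (h.flagAdj_adj i Φ)).2

/-- Passing to the `j`-adjacent flag does not touch the ranks `i - 1`, `i`, `i + 1`, which alone
determine the new face of rank `i`. -/
theorem adj_comm {i j : Fin N} (hij : (i : ℕ) + 2 ≤ j) (Φ : Flag α) :
    h.adj i (h.adj j Φ) = h.adj j (h.adj i Φ) := by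
  rw [← h.flagAdj_iff, h.flagAdj_iff_face]
  have hi : h.face (h.adj i (h.adj j Φ)) i.succ.castSucc = h.face (h.adj i Φ) i.succ.castSucc :=
    h.face_eq_of_flagAdj (h.flagAdj_adj i _) (h.flagAdj_adj i _)
      fun k _ _ => h.face_adj (by omega)
  refine ⟨fun k hk => ?_, ?_⟩
  · by_cases hki : (k : ℕ) = i + 1
    · obtain rfl : k = i.succ.castSucc := Fin.ext (by simp [hki])
      exact hi.symm
    · rw [h.face_adj hki, h.face_adj hki, h.face_adj hk]
  · rw [h.face_adj (by simp; omega), h.face_adj (by simp; omega)]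
    exact h.face_adj_ne j Φ

/-- In the path given by strong flag-connectedness a step of colour outside `I` is impossible: it
would change a face common to `Φ` and `Ψ`. The permutations `r` are arbitrary because the
connectedness of `flagManiplex` is itself derived from this. -/
theorem linked_adj {I : Set (Fin N)} {r : Fin N → Equiv.Perm (Flag α)}
    (hr : ∀ i Φ, r i Φ = h.adj i Φ) {Φ Ψ : Flag α}
    (hΦΨ : ∀ j : Fin N, j ∉ I → h.face Φ j.succ.castSucc = h.face Ψ j.succ.castSucc) :
    Linked r I Φ Ψ := by
  have key : ∀ B : Flag α, Relation.ReflTransGen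
      (fun A B : Flag α => (∃ i : ℤ, FlagAdj i A B) ∧ (Φ : Set α) ∩ Ψ ⊆ B) Φ B →
      Linked r I Φ B ∧ (Φ : Set α) ∩ Ψ ⊆ B := by
    intro B hB
    induction hB with
    | refl => exact ⟨Linked.refl _, Set.inter_subset_left⟩
    | @tail A B _ hs ih =>
      obtain ⟨⟨i, hi⟩, hsub⟩ := hs
      refine ⟨?_, hsub⟩
      obtain ⟨j, rfl⟩ := h.exists_of_flagAdj hi
      have hBj := h.flagAdj_iff.1 hi
      rw [← hr] at hBj
      subst hBj
      refine ih.1.tail ?_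
      by_contra hj
      have hmem : h.face Φ j.succ.castSucc ∈ (Φ : Set α) ∩ Ψ :=
        ⟨h.face_mem _ _, h.face_mem_iff.2 (hΦΨ j hj)⟩
      apply (h.flagAdj_iff_face.1 hi).2
      rw [← h.face_mem_iff.1 (hsub hmem), ← h.face_mem_iff.1 (ih.2 hmem)]
  exact (key Ψ (h.strongly_flag_connected Φ Ψ)).1

/-- The maniplex formed by the flags of a polytope. -/
noncomputable def flagManiplex : Maniplex.{u} N where
  Flags := Flag α
  r i := Function.Involutive.toPerm (h.adj i) (h.adj_adj i)
  nonempty := ⟨(IsChain.exists_subset_flag (c := (∅ : Set α)) (by simp)).choose⟩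
  involutive := h.adj_adj
  fixed_point_free i Φ e := (h.flagAdj_adj i Φ).1 e.symm
  distinct i j Φ hij e := by
    apply h.face_adj_ne i Φ
    have : h.adj i Φ = h.adj j Φ := e
    rw [this, h.face_adj]
    simpa [Fin.ext_iff] using hij
  squares i j hij Φ := h.adj_comm hij Φ
  connected Φ Ψ := by
    have := (h.linked_adj (r := fun i => Function.Involutive.toPerm (h.adj i) (h.adj_adj i))
      (fun _ _ => rfl) (I := Set.univ) (Φ := Φ) (Ψ := Ψ) (by simp)).exists_mem_closure
    rwa [Set.image_univ] at this

theorem flagManiplex_r (i : Fin N) (Φ : Flag α) : h.flagManiplex.r i Φ = h.adj i Φ := rfl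

theorem linked_flagManiplex {I : Set (Fin N)} {Φ Ψ : Flag α}
    (hΦΨ : ∀ j : Fin N, j ∉ I → h.face Φ j.succ.castSucc = h.face Ψ j.succ.castSucc) :
    Linked h.flagManiplex.r I Φ Ψ :=
  h.linked_adj (fun _ _ => rfl) hΦΨ

theorem face_eq_of_linked {I : Set (Fin N)} {Φ Ψ : Flag α} (hl : Linked h.flagManiplex.r I Φ Ψ)
    {k : Fin (N + 2)} (hk : ∀ i ∈ I, (i : ℕ) + 1 ≠ k) : h.face Ψ k = h.face Φ k :=
  Linked.eq_of_invariant (fun Ω => h.face Ω k)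
    (fun i hi _ => h.face_adj (fun e => hk i hi e.symm)) hl

theorem isPolytopal_flagManiplex : h.flagManiplex.IsPolytopal := by
  intro I Φ Ψ hI
  refine h.linked_flagManiplex fun j hj => (h.face_eq_of_linked (hI j hj) fun i hi e => hi ?_).symm
  simp only [Fin.val_castSucc, Fin.val_succ, Nat.add_right_cancel_iff] at e
  exact Fin.ext e

/-! ### Automorphisms and colourings -/

theorem map_adj {β : Type u} [PartialOrder β] [BoundedOrder β] (h' : IsPolytope N β) (e : α ≃o β)
    (i : Fin N) (Φ : Flag α) : Flag.map e (h.adj i Φ) = h'.adj i (Flag.map e Φ) :=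
  h'.flagAdj_iff.1 ((h.flagAdj_adj i Φ).map e)

theorem map_face {β : Type u} [PartialOrder β] [BoundedOrder β] (h' : IsPolytope N β) (e : α ≃o β)
    (Φ : Flag α) (k : Fin (N + 2)) : e (h.face Φ k) = h'.face (Flag.map e Φ) k :=
  h'.eq_face (Set.mem_image_of_mem e (h.face_mem Φ k)) (by rw [faceRank_orderIso, h.faceRank_face])

/-- Automorphisms commute with adjacency, so on a connected flag graph the image of one flag
determines all others. -/
theorem orderIso_ext {e e' : α ≃o α} {Φ : Flag α} (hΦ : Flag.map e Φ = Flag.map e' Φ) :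
    e = e' := by
  have hall : ∀ Ψ, Flag.map e Ψ = Flag.map e' Ψ := by
    intro Ψ
    have hl := h.flagManiplex.linked_univ Φ Ψ
    induction hl with
    | refl => exact hΦ
    | tail _ hs ih =>
      obtain ⟨i, -, rfl⟩ := hs
      rw [h.flagManiplex_r, h.map_adj h, h.map_adj h, ih]
  ext F
  obtain ⟨Ψ, hF⟩ := Flag.exists_mem F
  obtain ⟨k, rfl, -⟩ := h.exists_eq_face hF
  rw [h.map_face h, h.map_face h, hall]

theorem isFlagColouring_iff {c : Flag α → Bool} :
    IsFlagColouring c ↔ ∀ i Φ, c (h.adj i Φ) = !c Φ := by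
  constructor
  · intro hc i Φ
    have := hc _ _ _ (h.flagAdj_adj i Φ)
    revert this
    cases c Φ <;> cases c (h.adj i Φ) <;> simp
  · intro hc i Φ Ψ hadj
    obtain ⟨j, rfl⟩ := h.exists_of_flagAdj hadj
    rw [h.flagAdj_iff.1 hadj, hc]
    cases c Φ <;> simp

theorem colouring_eq {c c' : Flag α → Bool} (hc : IsFlagColouring c) (hc' : IsFlagColouring c')
    {Φ : Flag α} (hΦ : c Φ = c' Φ) : c = c' := by
  funext Ψ
  have hl := h.flagManiplex.linked_univ Φ Ψ
  rw [h.isFlagColouring_iff] at hc hc'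
  induction hl with
  | refl => exact hΦ
  | tail _ hs ih =>
    obtain ⟨i, -, rfl⟩ := hs
    rw [h.flagManiplex_r, hc, hc', ih]

/-- By connectedness the only colourings are `c` and its complement. -/
theorem mem_whiteFlags_iff {c : Flag α → Bool} (hc : IsFlagColouring c) {Φ Ψ : Flag α} :
    Ψ ∈ whiteFlags Φ ↔ c Ψ = c Φ := by
  refine ⟨fun hw => hw c hc, fun e c' hc' => ?_⟩
  by_cases hΦ : c' Φ = c Φ
  · rw [h.colouring_eq hc' hc hΦ, e]
  · have hnot : IsFlagColouring fun Φ => !c Φ := fun i A B hAB => by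
      have := hc i A B hAB
      simpa using this
    have : c' = fun Φ => !c Φ := h.colouring_eq hc' hnot (Φ := Φ) (by
      revert hΦ
      cases c' Φ <;> cases c Φ <;> simp)
    rw [this]
    simp [e]

theorem comp_map_colouring {c : Flag α → Bool} (hc : IsFlagColouring c) {e : α ≃o α} {Φ : Flag α}
    (hΦ : c (Flag.map e Φ) = c Φ) (Ψ : Flag α) : c (Flag.map e Ψ) = c Ψ :=
  congrFun (h.colouring_eq (c := fun Ψ => c (Flag.map e Ψ))
    (fun i _ _ hAB => hc i _ _ (hAB.map e)) hc hΦ) Ψ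

end IsPolytope

/-- Without a colouring every flag is white, and a rotary polytope is then regular. -/
theorem IsChiralPolytope.exists_colouring {α : Type u} [PartialOrder α]
    (hα : IsChiralPolytope α) : ∃ c : Flag α → Bool, IsFlagColouring c := by
  by_contra hno
  push Not at hno
  refine hα.2 fun Φ Ψ => ?_
  obtain ⟨γ, -, hγ⟩ := hα.1 Φ Φ (fun c hc => absurd hc (hno c)) Ψ (fun c hc => absurd hc (hno c))
  exact ⟨γ, hγ⟩

/-! ### Automorphisms of `2s^(M - 1)` -/

/-- The case `d = 0` is included: it says that no positive iterate fixes `x`. -/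
theorem minimalPeriod_eq_of_forall_dvd {X : Type*} {f : X → X} {x : X} {d : ℕ}
    (h : ∀ m, Function.IsPeriodicPt f m x ↔ d ∣ m) : Function.minimalPeriod f x = d :=
  Nat.dvd_antisymm
    (Function.isPeriodicPt_iff_minimalPeriod_dvd.1 ((h d).2 dvd_rfl))
    ((h _).1 (Function.isPeriodicPt_minimalPeriod f x))

namespace Maniplex

variable {n : ℕ} {M : Maniplex.{u} n}

theorem mem_aut {γ : Equiv.Perm M.Flags} : γ ∈ M.aut ↔ ∀ i x, γ (M.r i x) = M.r i (γ x) := by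
  rw [aut, Subgroup.mem_centralizer_iff]
  constructor
  · intro h i x
    exact (congrArg (fun g : Equiv.Perm M.Flags => g x) (h _ ⟨i, rfl⟩)).symm
  · rintro h _ ⟨i, rfl⟩
    ext x
    exact (h i x).symm

theorem aut_r (γ : M.aut) (i : Fin n) (x : M.Flags) :
    (γ : Equiv.Perm M.Flags) (M.r i x) = M.r i ((γ : Equiv.Perm M.Flags) x) :=
  mem_aut.1 γ.2 i x

theorem aut_ext {γ γ' : M.aut} {x : M.Flags}
    (h : (γ : Equiv.Perm M.Flags) x = (γ' : Equiv.Perm M.Flags) x) : γ = γ' := by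
  apply Subtype.ext
  ext y
  have hl := M.linked_univ x y
  induction hl with
  | refl => exact h
  | tail _ hs ih =>
    obtain ⟨i, -, rfl⟩ := hs
    rw [aut_r, aut_r, ih]

/-- The action of an automorphism on the facets. -/
def facetMap (γ : M.aut) (F : M.Facet) : M.Facet :=
  ⟨(γ : Equiv.Perm M.Flags) '' F.1, by
    obtain ⟨S, x, rfl⟩ := F
    refine ⟨(γ : Equiv.Perm M.Flags) x, ?_⟩
    have hcomm : ∀ g ∈ M.facetGroup, ∀ y, (γ : Equiv.Perm M.Flags) (g y) =
        g ((γ : Equiv.Perm M.Flags) y) := by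
      intro g hg
      induction hg using Subgroup.closure_induction with
      | mem g hg =>
        obtain ⟨i, -, rfl⟩ := hg
        exact aut_r γ i
      | one => exact fun _ => rfl
      | mul a b _ _ iha ihb => exact fun y => by simp [iha, ihb]
      | inv a _ iha =>
        intro y
        rw [Equiv.Perm.eq_inv_iff_eq, ← iha]
        simp
    ext y
    constructor
    · rintro ⟨_, ⟨g, hg, rfl⟩, rfl⟩
      exact ⟨g, hg, (hcomm g hg x).symm⟩
    · rintro ⟨g, hg, rfl⟩
      exact ⟨g x, ⟨g, hg, rfl⟩, hcomm g hg x⟩⟩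

theorem facetMap_one : facetMap (1 : M.aut) = id := by
  funext F
  exact Subtype.ext (Set.image_id _)

theorem facetMap_mul (γ δ : M.aut) : facetMap (γ * δ) = facetMap γ ∘ facetMap δ := by
  funext F
  exact Subtype.ext (Set.image_comp (γ : Equiv.Perm M.Flags) (δ : Equiv.Perm M.Flags) F.1)

theorem facetMap_facetOf (γ : M.aut) (x : M.Flags) :
    facetMap γ (M.facetOf x) = M.facetOf ((γ : Equiv.Perm M.Flags) x) := by
  obtain ⟨y, hy⟩ := (facetMap γ (M.facetOf x)).2
  have hmem : (γ : Equiv.Perm M.Flags) x ∈ M.facetSet y := by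
    rw [← hy]
    exact ⟨x, ⟨1, one_mem _, rfl⟩, rfl⟩
  have hF : facetMap γ (M.facetOf x) = M.facetOf y := Subtype.ext hy
  rw [hF]
  apply Subtype.ext
  obtain ⟨g, hg, hgy⟩ := hmem
  rw [← hgy]
  ext z
  constructor
  · rintro ⟨k, hk, rfl⟩
    exact ⟨k * g⁻¹, mul_mem hk (inv_mem hg), by simp⟩
  · rintro ⟨k, hk, rfl⟩
    exact ⟨k * g, mul_mem hk hg, rfl⟩

variable (s : ℕ) (x₀ : M.Flags)

/-- The action of an automorphism on the vectors indexed by the facets. -/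
noncomputable def vectorMap (γ : M.aut) : M.vectorGroup s →+ M.vectorGroup s :=
  ((Finsupp.mapDomain.addMonoidHom (facetMap γ)).comp (M.vectorGroup s).subtype).codRestrict _
    fun v => by
      have hv : Finsupp.liftAddHom (fun _ : M.Facet => AddMonoidHom.id (ZMod s))
        (v : M.Facet →₀ ZMod s) = 0 := v.2
      change Finsupp.liftAddHom (fun _ : M.Facet => AddMonoidHom.id (ZMod s))
        (Finsupp.mapDomain (facetMap γ) (v : M.Facet →₀ ZMod s)) = 0
      rw [← hv, Finsupp.liftAddHom_apply, Finsupp.liftAddHom_apply]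
      exact Finsupp.sum_mapDomain_index (by simp) (by simp)

theorem coe_vectorMap (γ : M.aut) (v : M.vectorGroup s) :
    (vectorMap s γ v : M.Facet →₀ ZMod s) = Finsupp.mapDomain (facetMap γ) v := rfl

theorem vectorMap_one (v : M.vectorGroup s) : vectorMap s 1 v = v :=
  Subtype.ext (by rw [coe_vectorMap, facetMap_one, Finsupp.mapDomain_id])

theorem vectorMap_mul (γ δ : M.aut) (v : M.vectorGroup s) :
    vectorMap s (γ * δ) v = vectorMap s γ (vectorMap s δ v) :=
  Subtype.ext (by
    rw [coe_vectorMap, coe_vectorMap, coe_vectorMap, facetMap_mul, Finsupp.mapDomain_comp])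

/-- Writing `0` for the base facet, `e_j - e_0` goes to `e_{γj} - e_{γ0} = a_{γj} - a_{γ0}`. The
defect `a_{γ0}` is what `twoSMap` adds on the layer `δ = 1` to commute with the last colour. -/
theorem vectorMap_facetVector (γ : M.aut) (x : M.Flags) :
    vectorMap s γ (M.facetVector x₀ s (M.facetOf x)) =
      M.facetVector x₀ s (M.facetOf ((γ : Equiv.Perm M.Flags) x)) -
        M.facetVector x₀ s (M.facetOf ((γ : Equiv.Perm M.Flags) x₀)) := by
  apply Subtype.ext
  rw [coe_vectorMap]
  simp only [facetVector, AddSubgroupClass.coe_sub, sub_sub_sub_cancel_right]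
  rw [← Finsupp.mapDomain.addMonoidHom_apply, map_sub]
  simp [facetMap_facetOf]

/-- The extension of an automorphism of `M` to `2s^(M - 1)`, as a map. -/
noncomputable def twoSMap (γ : M.aut) (z : M.TwoSFlags s) : M.TwoSFlags s :=
  ((γ : Equiv.Perm M.Flags) z.1, vectorMap s γ z.2.1 +
    (if z.2.2 = true then M.facetVector x₀ s (M.facetOf ((γ : Equiv.Perm M.Flags) x₀)) else 0),
    z.2.2)

theorem facetVector_base : M.facetVector x₀ s (M.facetOf x₀) = 0 :=
  Subtype.ext (by simp [facetVector])

theorem twoSMap_one (z : M.TwoSFlags s) : twoSMap s x₀ 1 z = z := by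
  obtain ⟨x, v, d⟩ := z
  cases d <;> simp [twoSMap, vectorMap_one, facetVector_base]

theorem twoSMap_mul (γ δ : M.aut) (z : M.TwoSFlags s) :
    twoSMap s x₀ (γ * δ) z = twoSMap s x₀ γ (twoSMap s x₀ δ z) := by
  obtain ⟨x, v, d⟩ := z
  cases d
  · simp [twoSMap, vectorMap_mul]
  · simp [twoSMap, vectorMap_mul, vectorMap_facetVector, add_assoc]

theorem twoS_r_castSucc (i : Fin n) (x : M.Flags) (v : M.vectorGroup s) (d : Bool) :
    (M.twoS x₀ s).r i.castSucc ((x, v, d) : M.TwoSFlags s) = ((M.r i x, v, d) : M.TwoSFlags s) := by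
  change M.twoSPerm x₀ s i.castSucc (x, v, d) = _
  simp

theorem twoS_r_last (x : M.Flags) (v : M.vectorGroup s) (d : Bool) :
    (M.twoS x₀ s).r (Fin.last n) ((x, v, d) : M.TwoSFlags s) =
      ((x, (if d = true then v - M.facetVector x₀ s (M.facetOf x)
        else v + M.facetVector x₀ s (M.facetOf x)), !d) : M.TwoSFlags s) := by
  change M.twoSPerm x₀ s (Fin.last n) (x, v, d) = _
  simp

/-- The extension of an automorphism of `M` to `2s^(M - 1)`, as a permutation. -/
noncomputable def twoSMapPerm (γ : M.aut) : Equiv.Perm (M.TwoSFlags s) where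
  toFun := twoSMap s x₀ γ
  invFun := twoSMap s x₀ γ⁻¹
  left_inv z := by rw [← twoSMap_mul, inv_mul_cancel, twoSMap_one]
  right_inv z := by rw [← twoSMap_mul, mul_inv_cancel, twoSMap_one]

/-- The extension of an automorphism of `M` to `2s^(M - 1)`. -/
noncomputable def twoSLift (γ : M.aut) : (M.twoS x₀ s).aut :=
  ⟨twoSMapPerm s x₀ γ, by
    refine mem_aut.2 ?_
    rintro i ⟨x, v, d⟩
    induction i using Fin.lastCases with
    | last =>
      change twoSMap s x₀ γ (M.twoSPerm x₀ s (Fin.last n) (x, v, d)) =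
        M.twoSPerm x₀ s (Fin.last n) (twoSMap s x₀ γ (x, v, d))
      cases d <;> simp [twoSMap, vectorMap_facetVector] <;> abel
    | cast i =>
      change twoSMap s x₀ γ (M.twoSPerm x₀ s i.castSucc (x, v, d)) =
        M.twoSPerm x₀ s i.castSucc (twoSMap s x₀ γ (x, v, d))
      simp [twoSMap, aut_r]⟩

theorem twoSLift_base (γ : M.aut) :
    (twoSLift s x₀ γ : Equiv.Perm (M.twoS x₀ s).Flags) (M.twoSBase x₀ s) =
      (((γ : Equiv.Perm M.Flags) x₀, 0, false) : M.TwoSFlags s) := by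
  change twoSMap s x₀ γ (x₀, 0, false) = _
  simp [twoSMap]

/-- The negation of vectors, as a permutation of the flags of `2s^(M - 1)`. -/
noncomputable def twoSFlipPerm : Equiv.Perm (M.TwoSFlags s) :=
  Function.Involutive.toPerm (fun z : M.TwoSFlags s => (z.1, -z.2.1, !z.2.2)) (by
    rintro ⟨x, v, d⟩
    simp)

theorem twoSFlipPerm_apply (x : M.Flags) (v : M.vectorGroup s) (d : Bool) :
    twoSFlipPerm s (x, v, d) = (x, -v, !d) := rfl

/-- The automorphism of `2s^(M - 1)` that negates the vectors. -/
noncomputable def twoSFlip : (M.twoS x₀ s).aut :=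
  ⟨twoSFlipPerm s, by
    refine mem_aut.2 ?_
    rintro i ⟨x, v, d⟩
    induction i using Fin.lastCases with
    | last =>
      change twoSFlipPerm s (M.twoSPerm x₀ s (Fin.last n) (x, v, d)) =
        M.twoSPerm x₀ s (Fin.last n) (twoSFlipPerm s (x, v, d))
      cases d <;> simp [twoSFlipPerm_apply] <;> abel
    | cast i =>
      change twoSFlipPerm s (M.twoSPerm x₀ s i.castSucc (x, v, d)) =
        M.twoSPerm x₀ s i.castSucc (twoSFlipPerm s (x, v, d))
      simp [twoSFlipPerm_apply]⟩

theorem twoSFlip_apply (x : M.Flags) (v : M.vectorGroup s) (d : Bool) :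
    (twoSFlip s x₀ : Equiv.Perm (M.twoS x₀ s).Flags) ((x, v, d) : M.TwoSFlags s) =
      ((x, -v, !d) : M.TwoSFlags s) := rfl

theorem exists_twoS_abstractRotation (hM : M.IsRegular) {i : ℕ} (h1 : 1 ≤ i) (h2 : i ≤ n) :
    ∃ γ : (M.twoS x₀ s).aut, (M.twoS x₀ s).IsAbstractRotation (M.twoSBase x₀ s) i γ := by
  obtain ⟨a, rfl⟩ : ∃ a : Fin n, i = a + 1 := ⟨⟨i - 1, by omega⟩, by simp; omega⟩
  have hlift : ∀ y, ∃ γ : (M.twoS x₀ s).aut,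
      (γ : Equiv.Perm (M.twoS x₀ s).Flags) (M.twoSBase x₀ s) =
        ((y, 0, false) : M.TwoSFlags s) := by
    intro y
    obtain ⟨γ, hγ, rfl⟩ := hM x₀ y
    exact ⟨twoSLift s x₀ ⟨γ, hγ⟩, twoSLift_base s x₀ ⟨γ, hγ⟩⟩
  by_cases ha : (a : ℕ) + 1 < n
  · obtain ⟨γ, hγ⟩ := hlift (M.r a (M.r ⟨a + 1, ha⟩ x₀))
    refine ⟨γ, a.castSucc, (⟨a + 1, ha⟩ : Fin n).castSucc, rfl, rfl, hγ.trans ?_⟩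
    rw [twoSBase, twoS_r_castSucc, twoS_r_castSucc]
  -- Since `a_0 = 0`, the last colour sends the base flag to `(x₀, 0, 1)`; the flip supplies this
  -- change of layer and the lift moves `x₀`.
  · obtain ⟨γ, hγ⟩ := hlift (M.r a x₀)
    refine ⟨twoSFlip s x₀ * γ, a.castSucc, Fin.last n, rfl, ?_, ?_⟩
    · simp
      omega
    · refine (congrArg (twoSFlip s x₀ : Equiv.Perm (M.twoS x₀ s).Flags) hγ).trans ?_
      rw [twoSFlip_apply, twoSBase, twoS_r_last, twoS_r_castSucc]
      simp [facetVector_base]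
      rfl

/-! ### The last entry of the type of `2s^(M - 1)` -/

/-- If one edge of colour `n - 1` stayed inside a facet, all would by regularity, and connectedness
would leave a single facet. -/
theorem facetOf_r_ne (hM : M.IsRegular) (hne : Nontrivial M.Facet) {l : Fin n}
    (hl : (l : ℕ) + 1 = n) (x : M.Flags) : M.facetOf (M.r l x) ≠ M.facetOf x := by
  intro e
  have hall : ∀ y, M.facetOf (M.r l y) = M.facetOf y := by
    intro y
    obtain ⟨γ, hγ, rfl⟩ := hM x y
    have := congrArg (facetMap ⟨γ, hγ⟩) e
    rw [facetMap_facetOf, facetMap_facetOf, aut_r] at this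
    exact this
  have hconst : ∀ y, M.facetOf y = M.facetOf x := fun y =>
    Linked.eq_of_invariant M.facetOf (fun i _ z => by
      by_cases hi : (i : ℕ) + 1 < n
      · exact M.facetOf_r i hi z
      · obtain rfl : i = l := Fin.ext (by omega)
        exact hall z) (M.linked_univ x y)
  obtain ⟨⟨_, y, rfl⟩, ⟨_, z, rfl⟩, hyz⟩ := hne
  exact hyz ((hconst y).trans (hconst z).symm)

theorem nsmul_facetVector_sub {x y : M.Flags} (hxy : M.facetOf y ≠ M.facetOf x) (k : ℕ) :
    k • (M.facetVector x₀ s (M.facetOf x) - M.facetVector x₀ s (M.facetOf y)) = 0 ↔ s ∣ k := by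
  rw [← ZMod.natCast_eq_zero_iff]
  have hcoe : ((k • (M.facetVector x₀ s (M.facetOf x) - M.facetVector x₀ s (M.facetOf y)) :
      M.vectorGroup s) : M.Facet →₀ ZMod s) =
      Finsupp.single (M.facetOf x) (k : ZMod s) - Finsupp.single (M.facetOf y) (k : ZMod s) := by
    simp [facetVector, smul_sub]
  constructor
  · intro h
    rw [h] at hcoe
    have := DFunLike.congr_fun hcoe (M.facetOf x)
    simpa [hxy] using this.symm
  · intro h
    apply Subtype.ext
    rw [hcoe, h]
    simp

/-- An odd number of steps changes `δ`. Two steps restore `x` and `δ` and add `±(a_j - a_k)`, with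
`j` and `k` the distinct facets of `x` and `r_{n-1} x`. This equals `±(e_j - e_k)`, whose multiple
by `m` vanishes exactly when `s ∣ m`. -/
theorem minimalPeriod_twoS (hM : M.IsRegular) (hne : Nontrivial M.Facet) {l : Fin n}
    (hl : (l : ℕ) + 1 = n) (z : M.TwoSFlags s) :
    Function.minimalPeriod (fun w => (M.twoS x₀ s).r l.castSucc ((M.twoS x₀ s).r (Fin.last n) w))
      z = 2 * s := by
  set f : M.TwoSFlags s → M.TwoSFlags s :=
    fun w => (M.twoS x₀ s).r l.castSucc ((M.twoS x₀ s).r (Fin.last n) w) with hf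
  have hfa : ∀ x v d, f (x, v, d) = (M.r l x, (if d = true then
      v - M.facetVector x₀ s (M.facetOf x) else v + M.facetVector x₀ s (M.facetOf x)), !d) := by
    intro x v d
    simp only [hf]
    rw [twoS_r_last, twoS_r_castSucc]
  obtain ⟨x, v, d⟩ := z
  set t := M.facetVector x₀ s (M.facetOf x) - M.facetVector x₀ s (M.facetOf (M.r l x)) with ht
  have hf2 : ∀ v, f^[2] (x, v, d) = (x, (if d = true then v - t else v + t), d) := by
    intro v
    rw [Function.iterate_succ_apply, Function.iterate_one, hfa, hfa, M.involutive]
    cases d <;> simp [ht] <;> abel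
  have hf2k : ∀ (k : ℕ) (v), f^[2 * k] (x, v, d) =
      (x, (if d = true then v - k • t else v + k • t), d) := by
    intro k
    induction k with
    | zero => intro v; simp
    | succ k ih =>
      intro v
      rw [mul_add, mul_one, Function.iterate_add_apply, hf2, ih]
      cases d <;> simp [add_smul] <;> abel
  have hk0 : ∀ k : ℕ, k • t = 0 ↔ s ∣ k := nsmul_facetVector_sub s x₀ (facetOf_r_ne hM hne hl x)
  refine minimalPeriod_eq_of_forall_dvd fun m => ?_
  rcases Nat.even_or_odd' m with ⟨k, rfl | rfl⟩
  · rw [Nat.mul_dvd_mul_iff_left (by norm_num), ← hk0]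
    change f^[2 * k] (x, v, d) = (x, v, d) ↔ _
    rw [hf2k]
    cases d <;> simp
  · constructor
    · intro h
      change f^[2 * k + 1] (x, v, d) = (x, v, d) at h
      rw [Function.iterate_succ_apply', hf2k, hfa] at h
      simp at h
    · intro h
      have := (dvd_mul_right 2 s).trans h
      omega

end Maniplex

/-! ### The mix of two maniplexes -/

namespace Maniplex

variable {n : ℕ} (M₁ M₂ : Maniplex.{u} n)

/-- The simultaneous action of the adjacency permutations on pairs of flags. -/
def prodPerm (i : Fin n) : Equiv.Perm (M₁.Flags × M₂.Flags) :=
  Equiv.prodCongr (M₁.r i) (M₂.r i)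

theorem prodPerm_apply (i : Fin n) (w : M₁.Flags × M₂.Flags) :
    prodPerm M₁ M₂ i w = (M₁.r i w.1, M₂.r i w.2) := rfl

theorem prodPerm_prodPerm (i : Fin n) (w : M₁.Flags × M₂.Flags) :
    prodPerm M₁ M₂ i (prodPerm M₁ M₂ i w) = w := by
  simp [prodPerm_apply, M₁.involutive, M₂.involutive]

/-- The flags of the mix: the pairs of flags reachable from the pair of base flags. -/
abbrev MixFlags (a : M₁.Flags × M₂.Flags) : Type u :=
  {w : M₁.Flags × M₂.Flags // Linked (prodPerm M₁ M₂) Set.univ a w}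

/-- The adjacency permutations of the mix. -/
def mixPerm (a : M₁.Flags × M₂.Flags) (i : Fin n) : Equiv.Perm (MixFlags M₁ M₂ a) :=
  Function.Involutive.toPerm (fun w => ⟨prodPerm M₁ M₂ i w.1, w.2.tail (Set.mem_univ i)⟩)
    fun w => Subtype.ext (prodPerm_prodPerm M₁ M₂ i w.1)

theorem mixPerm_mixPerm (a : M₁.Flags × M₂.Flags) (i : Fin n) (w : MixFlags M₁ M₂ a) :
    mixPerm M₁ M₂ a i (mixPerm M₁ M₂ a i w) = w :=
  Subtype.ext (prodPerm_prodPerm M₁ M₂ i w.1)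

theorem linked_mixPerm (a : M₁.Flags × M₂.Flags) (w : MixFlags M₁ M₂ a) :
    Linked (mixPerm M₁ M₂ a) Set.univ ⟨a, Linked.refl a⟩ w := by
  obtain ⟨w, hw⟩ := w
  induction hw with
  | refl => exact Linked.refl _
  | tail hb hs ih =>
    obtain ⟨i, hi, rfl⟩ := hs
    exact ih.tail (i := i) hi

/-- The mix of two maniplexes with respect to base flags. -/
def mix (a : M₁.Flags × M₂.Flags) : Maniplex.{u} n where
  Flags := MixFlags M₁ M₂ a
  r := mixPerm M₁ M₂ a
  nonempty := ⟨⟨a, Linked.refl a⟩⟩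
  involutive := mixPerm_mixPerm M₁ M₂ a
  fixed_point_free i w e :=
    M₁.fixed_point_free i w.1.1 (congrArg (fun z : MixFlags M₁ M₂ a => z.1.1) e)
  distinct i j w hij e :=
    M₁.distinct i j w.1.1 hij (congrArg (fun z : MixFlags M₁ M₂ a => z.1.1) e)
  squares i j hij w := Subtype.ext (Prod.ext (M₁.squares i j hij w.1.1) (M₂.squares i j hij w.1.2))
  connected x y := by
    have := (((linked_mixPerm M₁ M₂ a x).symm (mixPerm_mixPerm M₁ M₂ a)).trans
      (linked_mixPerm M₁ M₂ a y)).exists_mem_closure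
    rwa [Set.image_univ] at this

variable {M₁ M₂}

/-- The pairs of automorphisms that map the mix to itself. -/
def mixGroup (a : M₁.Flags × M₂.Flags) : Subgroup (M₁.aut × M₂.aut) where
  carrier := {g | Linked (prodPerm M₁ M₂) Set.univ a
    ((g.1 : Equiv.Perm M₁.Flags) a.1, (g.2 : Equiv.Perm M₂.Flags) a.2)}
  one_mem' := Linked.refl a
  mul_mem' := fun {g h} hg hh => Linked.trans hg
    (Linked.map (r' := prodPerm M₁ M₂) (fun w : M₁.Flags × M₂.Flags =>
      ((g.1 : Equiv.Perm M₁.Flags) w.1, (g.2 : Equiv.Perm M₂.Flags) w.2))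
      (fun i _ w => Prod.ext (aut_r g.1 i w.1) (aut_r g.2 i w.2)) hh)
  inv_mem' := fun {g} hg => by
    have := (Linked.map (r' := prodPerm M₁ M₂) (fun w : M₁.Flags × M₂.Flags =>
      (((g⁻¹).1 : Equiv.Perm M₁.Flags) w.1, ((g⁻¹).2 : Equiv.Perm M₂.Flags) w.2))
      (fun i _ w => Prod.ext (aut_r g⁻¹.1 i w.1) (aut_r g⁻¹.2 i w.2)) hg).symm
      (prodPerm_prodPerm M₁ M₂)
    simpa using this

theorem linked_of_mem_mixGroup {a : M₁.Flags × M₂.Flags} {g : M₁.aut × M₂.aut}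
    (hg : g ∈ mixGroup a) {w : M₁.Flags × M₂.Flags}
    (hw : Linked (prodPerm M₁ M₂) Set.univ a w) :
    Linked (prodPerm M₁ M₂) Set.univ a
      ((g.1 : Equiv.Perm M₁.Flags) w.1, (g.2 : Equiv.Perm M₂.Flags) w.2) :=
  Linked.trans hg
    (Linked.map (r' := prodPerm M₁ M₂) (fun w : M₁.Flags × M₂.Flags =>
      ((g.1 : Equiv.Perm M₁.Flags) w.1, (g.2 : Equiv.Perm M₂.Flags) w.2))
      (fun i _ w => Prod.ext (aut_r g.1 i w.1) (aut_r g.2 i w.2)) hw)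

/-- The action on the mix of a pair of automorphisms. -/
def mixMap {a : M₁.Flags × M₂.Flags} (g : mixGroup a) (w : MixFlags M₁ M₂ a) :
    MixFlags M₁ M₂ a :=
  ⟨(((g : M₁.aut × M₂.aut).1 : Equiv.Perm M₁.Flags) w.1.1,
    ((g : M₁.aut × M₂.aut).2 : Equiv.Perm M₂.Flags) w.1.2), linked_of_mem_mixGroup g.2 w.2⟩

/-- The action on the mix of the pairs of automorphisms that map the mix to itself. -/
def mixHom (a : M₁.Flags × M₂.Flags) : mixGroup a →* (mix M₁ M₂ a).aut where
  toFun g := ⟨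
    { toFun := mixMap g
      invFun := mixMap g⁻¹
      left_inv := fun _ => Subtype.ext (Prod.ext
        (Equiv.symm_apply_apply ((g : M₁.aut × M₂.aut).1 : Equiv.Perm M₁.Flags) _)
        (Equiv.symm_apply_apply ((g : M₁.aut × M₂.aut).2 : Equiv.Perm M₂.Flags) _))
      right_inv := fun _ => Subtype.ext (Prod.ext
        (Equiv.apply_symm_apply ((g : M₁.aut × M₂.aut).1 : Equiv.Perm M₁.Flags) _)
        (Equiv.apply_symm_apply ((g : M₁.aut × M₂.aut).2 : Equiv.Perm M₂.Flags) _)) },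
    mem_aut.2 fun i _ => Subtype.ext (Prod.ext (aut_r (g : M₁.aut × M₂.aut).1 i _)
      (aut_r (g : M₁.aut × M₂.aut).2 i _))⟩
  map_one' := rfl
  map_mul' _ _ := rfl

theorem mixHom_injective (a : M₁.Flags × M₂.Flags) : Function.Injective (mixHom a) := by
  intro g h e
  have hw : mixMap g ⟨a, Linked.refl a⟩ = mixMap h ⟨a, Linked.refl a⟩ :=
    congrArg (fun γ : (mix M₁ M₂ a).aut =>
      (γ : Equiv.Perm (mix M₁ M₂ a).Flags) (⟨a, Linked.refl a⟩ : MixFlags M₁ M₂ a)) e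
  have hw' := congrArg Subtype.val hw
  exact Subtype.ext (Prod.ext (aut_ext (congrArg Prod.fst hw')) (aut_ext (congrArg Prod.snd hw')))

/-! ### Automorphisms of the poset of a maniplex -/

variable {M : Maniplex.{u} n}

/-- The action of an automorphism on the faces. -/
def posetMap (γ : M.aut) : M.Poset →o M.Poset :=
  OrderHom.antisymmetrization
    { toFun := fun F : M.PreFace => (⟨F.ht, (γ : Equiv.Perm M.Flags) F.flag⟩ : M.PreFace)
      monotone' := by
        rintro ⟨k, x⟩ ⟨l, y⟩ ⟨hkl, z, hxz, hzy⟩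
        exact ⟨hkl, (γ : Equiv.Perm M.Flags) z, hxz.map _ fun i _ => aut_r γ i,
          hzy.map _ fun i _ => aut_r γ i⟩ }

theorem posetMap_mul_apply (γ δ : M.aut) (F : M.Poset) :
    posetMap (γ * δ) F = posetMap γ (posetMap δ F) := by
  obtain ⟨k, x, rfl⟩ := exists_mkFace F
  rfl

theorem posetMap_one_apply (F : M.Poset) : posetMap 1 F = F := by
  obtain ⟨k, x, rfl⟩ := exists_mkFace F
  rfl

/-- The action of the automorphism group of a maniplex on its poset. -/
def posetHom (M : Maniplex.{u} n) : M.aut →* (M.Poset ≃o M.Poset) where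
  toFun γ := OrderIso.ofHomInv (posetMap γ) (posetMap γ⁻¹)
    (OrderHom.ext _ _ (funext fun F => by
      change posetMap γ (posetMap γ⁻¹ F) = F
      rw [← posetMap_mul_apply, mul_inv_cancel, posetMap_one_apply]))
    (OrderHom.ext _ _ (funext fun F => by
      change posetMap γ⁻¹ (posetMap γ F) = F
      rw [← posetMap_mul_apply, inv_mul_cancel, posetMap_one_apply]))
  map_one' := RelIso.ext posetMap_one_apply
  map_mul' γ δ := RelIso.ext (posetMap_mul_apply γ δ)

theorem map_posetHom_flagOf (γ : M.aut) (x : M.Flags) :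
    Flag.map (posetHom M γ) (flagOf x) = flagOf ((γ : Equiv.Perm M.Flags) x) := by
  refine (Flag.eq_of_subset ?_).symm
  rintro _ ⟨k, rfl⟩
  exact ⟨M.mkFace k x, ⟨k, rfl⟩, rfl⟩

end Maniplex

/-- The action of the automorphism group of a polytope on its flags. -/
noncomputable def IsPolytope.autHom {N : ℕ} {α : Type u} [PartialOrder α] [BoundedOrder α]
    (h : IsPolytope N α) : (α ≃o α) →* h.flagManiplex.aut where
  toFun γ := ⟨Flag.map γ, Maniplex.mem_aut.2 fun i Φ => h.map_adj h γ i Φ⟩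
  map_one' := Subtype.ext (Equiv.ext fun _ => Flag.ext (Set.image_id _))
  map_mul' γ δ := Subtype.ext (Equiv.ext fun Φ => Flag.ext (Set.image_comp γ δ (Φ : Flag α).carrier))

/-! ### Facets as sections -/

theorem faceRank_Iic {α : Type u} [PartialOrder α] {F : α} (G : Set.Iic F) :
    faceRank G = faceRank (G : α) := by
  rw [faceRank, faceRank]
  congr 3
  exact Order.height_eq_of_strictMono _ (Subtype.strictMono_coe _)
    (fun a b hb => ⟨⟨b, hb.le.trans a.2⟩, hb, rfl⟩) G

namespace Flag

variable {α : Type u} [PartialOrder α]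

/-- The flag of the section below `F` given by a flag through `F`. -/
def restrictIic (Φ : Flag α) {F : α} (hF : F ∈ Φ) : Flag (Set.Iic F) where
  carrier := {G | (G : α) ∈ Φ}
  Chain' := by
    intro G hG H hH _
    exact Φ.le_or_le hG hH
  max_chain' := by
    intro t ht hsub
    refine hsub.antisymm fun G hG => ?_
    have hFt : (⟨F, le_rfl⟩ : Set.Iic F) ∈ t := hsub hF
    -- Membership follows from comparability with all of `Φ`: elements below `F` belong to the chain
    -- `t`, and those above `F` are above `G`.
    refine Flag.mem_iff_forall_le_or_ge.2 fun H hH => ?_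
    rcases Φ.le_or_le hH hF with h | h
    · exact ht.total hG (hsub (show (⟨H, h⟩ : Set.Iic F) ∈ {G : Set.Iic F | (G : α) ∈ Φ} from hH))
    · exact Or.inl (le_trans G.2 h)

theorem restrictIic_surjective {F : α} (Ω : Flag (Set.Iic F)) :
    ∃ (Φ : Flag α) (hF : F ∈ Φ), Φ.restrictIic hF = Ω := by
  obtain ⟨Φ, hΦ⟩ := (Ω.chain_le.image (OrderEmbedding.subtype _)).exists_subset_flag
  have hF : F ∈ Φ := hΦ ⟨⟨F, le_rfl⟩, Ω.top_mem, rfl⟩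
  refine ⟨Φ, hF, (Flag.eq_of_subset fun G hG => ?_).symm⟩
  exact hΦ (Set.mem_image_of_mem (OrderEmbedding.subtype _) hG)

end Flag

theorem IsPolytope.flagAdj_restrictIic {N : ℕ} {α : Type u} [PartialOrder α] [BoundedOrder α]
    (h : IsPolytope N α) {F : α} {i : ℤ} (hi : i < faceRank F) {Φ Ψ : Flag α}
    (hΦ : F ∈ Φ) (hΨ : F ∈ Ψ) (hadj : FlagAdj i Φ Ψ) :
    FlagAdj i (Φ.restrictIic hΦ) (Ψ.restrictIic hΨ) := by
  refine ⟨fun e => hadj.1 (Flag.eq_of_subset fun G hG => ?_), fun G hG => ?_⟩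
  · by_cases hGi : faceRank G = i
    · rcases Φ.le_or_le hG hΦ with hle | hle
      · have hm : (⟨G, hle⟩ : Set.Iic F) ∈ Φ.restrictIic hΦ := hG
        rw [e] at hm
        exact hm
      · have := h.faceRank_strictMono.monotone hle
        omega
    · exact (hadj.2 G hGi).1 hG
  · exact hadj.2 _ (by rwa [faceRank_Iic] at hG)

/-- If the facets of `P` are isomorphic to `K`, which covers the regular maniplex `R`, then each
facet of `P` covers `R`, with an arbitrary value at one flag. -/
theorem exists_facet_cover {n : ℕ} {K P : Type u} [PartialOrder K] [PartialOrder P]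
    [BoundedOrder P] (hP : IsPolytope (n + 1) P) (hPext : IsExtension n K P) {R : Maniplex.{u} n}
    (hKR : PolytopeCovers K R) (hR : R.IsRegular) (Φ : Flag P) (x : R.Flags) :
    ∃ ψ : Flag P → R.Flags, ψ Φ = x ∧ ∀ Ψ : Flag P,
      hP.face Ψ (Fin.last n).succ.castSucc = hP.face Φ (Fin.last n).succ.castSucc →
        ∀ i : Fin n, ψ (hP.adj i.castSucc Ψ) = R.r i (ψ Ψ) := by
  classical
  obtain ⟨φ, -, hφ⟩ := hKR
  set F := hP.face Φ (Fin.last n).succ.castSucc with hF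
  have hrank : faceRank F = (n : ℤ) := by rw [hF, hP.faceRank_face]; simp
  obtain ⟨e⟩ := hPext F hrank
  have hmem : ∀ Ψ : Flag P, hP.face Ψ (Fin.last n).succ.castSucc = F → F ∈ Ψ := fun Ψ h =>
    h ▸ hP.face_mem _ _
  set ψ : Flag P → R.Flags := fun Ψ =>
    if h : F ∈ Ψ then φ (Flag.map e (Ψ.restrictIic h)) else x with hψ
  -- Regularity of `R` corrects the covering so that it takes the value `x` at `Φ`.
  obtain ⟨γ, hγ, hγx⟩ := hR (ψ Φ) x
  refine ⟨fun Ψ => γ (ψ Ψ), hγx, fun Ψ hΨ i => ?_⟩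
  have hΨF := hmem Ψ hΨ
  have hΨF' : F ∈ hP.adj i.castSucc Ψ := hmem _ (by
    rw [hP.face_adj, hΨ]
    simp
    omega)
  have hadj := hP.flagAdj_adj i.castSucc Ψ
  have := hφ i _ _ ((hP.flagAdj_restrictIic (by rw [hrank]; simp) hΨF hΨF' hadj).map e)
  simp only [hψ, dif_pos hΨF, dif_pos hΨF', this]
  exact Maniplex.mem_aut.1 hγ i _

/-! ### Extensions: the facets of a maniplex covering a polytope -/

namespace Maniplex

section Cover

variable {n : ℕ} {P : Type u} [PartialOrder P] [BoundedOrder P] (hP : IsPolytope (n + 1) P)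
  {M : Maniplex.{u} (n + 1)} (f : M.Flags → Flag P)

/-- The map on faces given by a map on flags. -/
noncomputable def coverFace (F : M.Poset) : P :=
  hP.face (f (ofAntisymmetrization (· ≤ ·) F : M.PreFace).flag)
    (ofAntisymmetrization (· ≤ ·) F : M.PreFace).ht

variable {f} (hf : ∀ i x, f (M.r i x) = hP.adj i (f x))
include hf

theorem face_cover_eq {k : Fin (n + 3)} {x y : M.Flags} (h : M.mkFace k x = M.mkFace k y) :
    hP.face (f x) k = hP.face (f y) k :=
  (hP.face_eq_of_linked
    ((mkFace_eq_mkFace.1 h).2.map (r' := hP.flagManiplex.r) f fun i _ => hf i)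
      fun _ hi => hi).symm

theorem coverFace_mkFace (k : Fin (n + 3)) (x : M.Flags) :
    coverFace hP f (M.mkFace k x) = hP.face (f x) k := by
  set a : M.PreFace := ofAntisymmetrization (· ≤ ·) (M.mkFace k x) with ha
  have h : M.mkFace a.ht a.flag = M.mkFace k x :=
    toAntisymmetrization_ofAntisymmetrization (α := M.PreFace) (· ≤ ·) (M.mkFace k x)
  obtain ⟨k', y⟩ := a
  obtain rfl : k' = k := (mkFace_eq_mkFace.1 h).1
  rw [coverFace, ← ha]
  exact face_cover_eq hP hf h

theorem coverFace_mono : Monotone (coverFace hP f) := by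
  intro F G h
  obtain ⟨k, x, rfl⟩ := exists_mkFace F
  obtain ⟨l, y, rfl⟩ := exists_mkFace G
  obtain ⟨hkl, z, h1, h2⟩ := mkFace_le_mkFace_iff_exists.1 h
  rw [← h1, ← h2, coverFace_mkFace hP hf, coverFace_mkFace hP hf]
  exact hP.face_le_iff.2 hkl

variable (hinj : ∀ x y, Linked M.r {Fin.last n}ᶜ x y → f x = f y → x = y)
include hinj

/-- The images are joined by a path avoiding both the colour `k - 1` and the last one. Its lift from
`x` stays in the facet and ends over `f y`, hence at `y`. -/
theorem mkFace_eq_of_face_eq {k : Fin (n + 3)} {x y : M.Flags}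
    (hxy : Linked M.r {Fin.last n}ᶜ x y) (h : hP.face (f x) k = hP.face (f y) k) :
    M.mkFace k x = M.mkFace k y := by
  have h0 := hxy.map (r' := hP.flagManiplex.r) f fun i _ => hf i
  have hl : Linked hP.flagManiplex.r {j | (j : ℕ) + 1 ≠ k ∧ j ≠ Fin.last n} (f x) (f y) := by
    refine hP.linked_flagManiplex fun j hj => ?_
    simp only [Set.mem_ofPred_eq, not_and_or, not_not] at hj
    rcases hj with hj | rfl
    · obtain rfl : k = j.succ.castSucc := Fin.ext (by simp [hj])
      exact h
    · refine (hP.face_eq_of_linked h0 fun i hi e => hi (Fin.ext ?_)).symm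
      simpa using e
  obtain ⟨z, hz, hzy⟩ := Linked.lift (r := M.r) f (fun i _ => hf i) hl
  obtain rfl := hinj z y (((hz.mono fun i hi => hi.2).symm M.involutive).trans hxy) hzy
  exact mkFace_eq_of_linked hz fun i hi => hi.1

/-- A flag of `P` through both faces and the facet of `f y` lifts to a flag `z` in the facet of `y`,
and `z` witnesses the incidence upstairs. -/
theorem mkFace_le_of_face_le {k l : Fin (n + 3)} {x y : M.Flags}
    (hxy : Linked M.r {Fin.last n}ᶜ x y) (h : hP.face (f x) k ≤ hP.face (f y) l)
    (hl : l ≤ (Fin.last n).succ.castSucc) : M.mkFace k x ≤ M.mkFace l y := by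
  have hkl : k ≤ l := by
    have := hP.faceRank_strictMono.monotone h
    rw [hP.faceRank_face, hP.faceRank_face] at this
    rw [Fin.le_def]
    omega
  have hxy' := hxy.map (r' := hP.flagManiplex.r) f fun i _ => hf i
  set F := hP.face (f y) (Fin.last n).succ.castSucc with hF
  have hlF : hP.face (f y) l ≤ F := hP.face_le_iff.2 hl
  have hc : IsChain (· ≤ ·) ({hP.face (f x) k, hP.face (f y) l, F} : Set P) := by
    refine IsChain.insert (IsChain.pair hlF) ?_
    rintro b (rfl | rfl) _
    · exact Or.inl h
    · exact Or.inl (h.trans hlF)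
  obtain ⟨Ω, hΩ⟩ := hc.exists_subset_flag
  have e1 := hP.face_mem_iff.1 (hΩ (Set.mem_insert _ _))
  have e2 := hP.face_mem_iff.1 (hΩ (Set.mem_insert_of_mem _ (Set.mem_insert _ _)))
  have e3 := hP.face_mem_iff.1
    (hΩ (Set.mem_insert_of_mem _ (Set.mem_insert_of_mem _ (Set.mem_singleton _))))
  have hlink : Linked hP.flagManiplex.r {Fin.last n}ᶜ (f y) Ω := by
    refine hP.linked_flagManiplex fun j hj => ?_
    simp only [Set.mem_compl_iff, not_not, Set.mem_singleton_iff] at hj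
    rw [hj]
    exact e3
  obtain ⟨z, hz, rfl⟩ := Linked.lift (r := M.r) f (fun i _ => hf i) hlink
  exact mkFace_le_mkFace_iff_exists.2 ⟨hkl, z,
    (mkFace_eq_of_face_eq hP hf hinj (hxy.trans hz) e1).symm,
    (mkFace_eq_of_face_eq hP hf hinj hz e2).symm⟩

omit hf hinj in
theorem linked_of_mkFace_eq {x y : M.Flags}
    (h : M.mkFace (Fin.last n).succ.castSucc x = M.mkFace (Fin.last n).succ.castSucc y) :
    Linked M.r {Fin.last n}ᶜ x y :=
  (mkFace_eq_mkFace.1 h).2.mono fun i hi => by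
    rintro rfl
    simp at hi

omit hf hinj in
theorem exists_mkFace_of_le {F : M.Poset} {x : M.Flags}
    (h : F ≤ M.mkFace (Fin.last n).succ.castSucc x) :
    ∃ k y, F = M.mkFace k y ∧ k ≤ (Fin.last n).succ.castSucc ∧ Linked M.r {Fin.last n}ᶜ x y := by
  obtain ⟨k, w, rfl⟩ := exists_mkFace F
  obtain ⟨hk, y, h1, h2⟩ := mkFace_le_mkFace_iff_exists.1 h
  exact ⟨k, y, h1.symm, hk, linked_of_mkFace_eq h2.symm⟩

/-- A covering of a polytope that is injective on facets preserves the facets. -/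
theorem nonempty_facet_orderIso (x : M.Flags) :
    Nonempty (Set.Iic (M.mkFace (Fin.last n).succ.castSucc x) ≃o
      Set.Iic (hP.face (f x) (Fin.last n).succ.castSucc)) := by
  let g : Set.Iic (M.mkFace (Fin.last n).succ.castSucc x) →
      Set.Iic (hP.face (f x) (Fin.last n).succ.castSucc) := fun F =>
    ⟨coverFace hP f F, by
      rw [Set.mem_Iic, ← coverFace_mkFace hP hf]
      exact coverFace_mono hP hf F.2⟩
  have hg : ∀ a b, g a ≤ g b ↔ a ≤ b := by
    rintro ⟨F, hF⟩ ⟨G, hG⟩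
    refine ⟨fun h => ?_, fun h => coverFace_mono hP hf h⟩
    obtain ⟨k, y, rfl, _, hy⟩ := exists_mkFace_of_le hF
    obtain ⟨l, z, rfl, hl, hz⟩ := exists_mkFace_of_le hG
    have h' : coverFace hP f (M.mkFace k y) ≤ coverFace hP f (M.mkFace l z) := h
    rw [coverFace_mkFace hP hf, coverFace_mkFace hP hf] at h'
    exact mkFace_le_of_face_le hP hf hinj ((hy.symm M.involutive).trans hz) h' hl
  refine ⟨RelIso.ofSurjective (OrderEmbedding.ofMapLEIff g hg) ?_⟩
  rintro ⟨A, hA⟩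
  -- For surjectivity, a flag through `A` and the facet is reached from `f x` inside the facet, so
  -- it lifts.
  obtain ⟨Ω, hAΩ, hFΩ⟩ := Flag.exists_mem_mem hA
  have hlink : Linked hP.flagManiplex.r {Fin.last n}ᶜ (f x) Ω := by
    refine hP.linked_flagManiplex fun j hj => ?_
    simp only [Set.mem_compl_iff, not_not, Set.mem_singleton_iff] at hj
    rw [hj]
    exact hP.face_mem_iff.1 hFΩ
  obtain ⟨z, hz, rfl⟩ := Linked.lift (r := M.r) f (fun i _ => hf i) hlink
  obtain ⟨k, rfl, -⟩ := hP.exists_eq_face hAΩ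
  have hxz : M.mkFace (Fin.last n).succ.castSucc x = M.mkFace (Fin.last n).succ.castSucc z :=
    mkFace_eq_of_linked hz fun i hi e => hi (Fin.ext (Nat.add_right_cancel e))
  refine ⟨⟨M.mkFace k z, ?_⟩, Subtype.ext (coverFace_mkFace hP hf k z)⟩
  rw [Set.mem_Iic, hxz]
  refine mkFace_mono z ?_
  have := hP.faceRank_strictMono.monotone hA
  rw [hP.faceRank_face, hP.faceRank_face] at this
  rw [Fin.le_def]
  omega

theorem isExtension_poset {K : Type u} [PartialOrder K] (hPext : IsExtension n K P) :
    IsExtension n K M.Poset := by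
  intro F hF
  obtain ⟨k, x, rfl⟩ := exists_mkFace F
  rw [faceRank_mkFace] at hF
  obtain rfl : k = (Fin.last n).succ.castSucc := Fin.ext (by simp; omega)
  obtain ⟨e⟩ := nonempty_facet_orderIso hP hf hinj x
  obtain ⟨e'⟩ := hPext (hP.face (f x) (Fin.last n).succ.castSucc) (by rw [hP.faceRank_face]; simp)
  exact ⟨e.trans e'⟩

end Cover

end Maniplex

/-- The entries of the type of an extension are those of the type of the facets, except for the
last one. -/
theorem IsExtension.encard_section {n : ℕ} {K Q : Type u} [PartialOrder K] [BoundedOrder K]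
    [PartialOrder Q] [BoundedOrder Q] (hQ : IsPolytope (n + 1) Q) (hext : IsExtension n K Q)
    {p : ℕ → ℕ∞} (hK : HasSchlafliType n K p) {i : ℕ} (h1 : 1 ≤ i) (hi : i < n) {F G : Q}
    (hF : faceRank F = (i : ℤ) - 2) (hG : faceRank G = (i : ℤ) + 1) (hFG : F ≤ G) :
    {H : Q | F ≤ H ∧ H ≤ G ∧ faceRank H = (i : ℤ) - 1}.encard = p i := by
  obtain ⟨Ω, hGΩ⟩ := Flag.exists_mem G
  obtain ⟨k, hk, hGk⟩ := hQ.exists_eq_face hGΩ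
  set T := hQ.face Ω (Fin.last n).succ.castSucc with hT
  -- As `i < n`, the rank `i + 1` of `G` is at most `n`, so the whole section lies in the facet `T`.
  have hGT : G ≤ T := by
    rw [hk]
    refine hQ.face_le_iff.2 ?_
    rw [Fin.le_def]
    simp
    omega
  obtain ⟨e⟩ := hext T (by rw [hQ.faceRank_face]; simp)
  have hrank : ∀ A : Set.Iic T, faceRank (e A) = faceRank (A : Q) := fun A => by
    rw [faceRank_orderIso, faceRank_Iic]
  have hcard := hK i h1 hi (e ⟨F, hFG.trans hGT⟩) (e ⟨G, hGT⟩) (by rw [hrank]; exact hF)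
    (by rw [hrank]; exact hG) (e.monotone hFG)
  rw [← hcard, ← (Subtype.val_injective.comp e.symm.injective).encard_image]
  congr 1
  ext H
  constructor
  · rintro ⟨hFH, hHG, hH⟩
    refine ⟨e ⟨H, hHG.trans hGT⟩, ⟨e.monotone hFH, e.monotone hHG, ?_⟩, by simp⟩
    rw [hrank]
    exact hH
  · rintro ⟨A, ⟨hFA, hAG, hA⟩, rfl⟩
    obtain ⟨⟨A, hAT⟩, rfl⟩ := e.surjective A
    rw [hrank] at hA
    rw [e.le_iff_le] at hFA hAG
    simp only [Function.comp_apply, OrderIso.symm_apply_apply]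
    exact ⟨hFA, hAG, hA⟩

/-- If an extension is regular, so are its facets. -/
theorem IsExtension.isRegularPolytope {n : ℕ} {K Q : Type u} [PartialOrder K] [PartialOrder Q]
    [BoundedOrder Q] (hQ : IsPolytope (n + 1) Q) (hext : IsExtension n K Q)
    (hreg : IsRegularPolytope Q) : IsRegularPolytope K := by
  intro Φ Ψ
  have Ω : Flag Q := (Flag.exists_mem (⊥ : Q)).choose
  have hTr : faceRank (hQ.face Ω (Fin.last n).succ.castSucc) = (n : ℤ) := by
    rw [hQ.faceRank_face]; simp
  set T := hQ.face Ω (Fin.last n).succ.castSucc with hT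
  obtain ⟨e⟩ := hext T hTr
  obtain ⟨Φ', hΦ', hΦ⟩ := Flag.restrictIic_surjective (Flag.map e.symm Φ)
  obtain ⟨Ψ', hΨ', hΨ⟩ := Flag.restrictIic_surjective (Flag.map e.symm Ψ)
  obtain ⟨γ, hγ⟩ := hreg Φ' Ψ'
  -- Both flags were extended through `T`, and the target flag has only one face of rank `n`; so `γ`
  -- restricts to the facet.
  have hγT : γ T = T :=
    hQ.eq_of_mem (hγ ▸ Set.mem_image_of_mem γ hΦ') hΨ' (faceRank_orderIso γ T)
  let δ : Set.Iic T ≃o Set.Iic T :=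
    { toFun := fun A => ⟨γ A, (γ.monotone A.2).trans hγT.le⟩
      invFun := fun A => ⟨γ.symm A, by
        rw [Set.mem_Iic, ← γ.le_iff_le, γ.apply_symm_apply, hγT]
        exact A.2⟩
      left_inv := fun A => Subtype.ext (γ.symm_apply_apply A)
      right_inv := fun A => Subtype.ext (γ.apply_symm_apply A)
      map_rel_iff' := γ.le_iff_le }
  refine ⟨(e.symm.trans δ).trans e, Flag.eq_of_subset ?_⟩
  rintro _ ⟨A, hA, rfl⟩
  have h1 : e.symm A ∈ Φ'.restrictIic hΦ' := hΦ ▸ Set.mem_image_of_mem e.symm hA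
  have h2 : δ (e.symm A) ∈ Ψ'.restrictIic hΨ' := by
    have h3 : γ (e.symm A : Q) ∈ Flag.map γ Φ' := Set.mem_image_of_mem γ h1
    rw [hγ] at h3
    exact h3
  rw [hΨ] at h2
  obtain ⟨B, hB, hBe⟩ := h2
  have : ((e.symm.trans δ).trans e) A = B := by
    simp [← hBe]
  rw [this]
  exact hB

/-! ### The last entry of the type -/

theorem minimalPeriod_of_semiconj {X Y : Type*} {f : X → Y} (hf : Function.Injective f)
    {g : X → X} {g' : Y → Y} (h : ∀ x, f (g x) = g' (f x)) (x : X) :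
    Function.minimalPeriod g' (f x) = Function.minimalPeriod g x := by
  have hiter : ∀ m, f (g^[m] x) = g'^[m] (f x) := fun m =>
    (Function.Semiconj.iterate_right (f := f) (ga := g) (gb := g') h m) x
  refine minimalPeriod_eq_of_forall_dvd fun m => ?_
  rw [← Function.isPeriodicPt_iff_minimalPeriod_dvd]
  change g'^[m] (f x) = f x ↔ g^[m] x = x
  rw [← hiter, hf.eq_iff]

/-- The cardinality of `ZMod d` is `d`, or `∞` for `d = 0`. It turns a minimal period, where `0`
means not periodic, into an entry of a type. -/
theorem card_zmod_lcm (a : ℕ) {b : ℕ} (hb : b ≠ 0) :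
    ENat.card (ZMod (Nat.lcm a b)) = lcmTop (ENat.card (ZMod a)) b := by
  rcases eq_or_ne a 0 with rfl | ha
  · rw [Nat.lcm_zero_left]
    simp [lcmTop, ZMod]
  · have : ∀ m : ℕ, m ≠ 0 → ENat.card (ZMod m) = m := fun m hm => by
      have := NeZero.mk hm
      rw [ENat.card_eq_coe_fintype_card, ZMod.card]
    rw [this a ha, lcmTop, if_neg (ENat.natCast_ne_top a), ENat.toNat_natCast]
    exact this _ (Nat.lcm_ne_zero ha hb)

theorem Equiv.Perm.zpow_apply_invariant {X β : Type*} {d : Equiv.Perm X} {f : X → β}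
    (hf : ∀ x, f (d x) = f x) (k : ℤ) (x : X) : f ((d ^ k) x) = f x := by
  induction k using Int.induction_on with
  | zero => rfl
  | succ k ih => rw [add_comm, zpow_add, zpow_one, Equiv.Perm.mul_apply, hf, ih]
  | pred k ih =>
    rw [← ih, ← hf ((d ^ (-(k : ℤ) - 1)) x), ← Equiv.Perm.mul_apply, ← zpow_one_add]
    congr 3
    ring

/-- The orbits of a dihedral group. -/
theorem Linked.exists_zpow {ι X : Type*} {r : ι → Equiv.Perm X} (hr : ∀ i x, r i (r i x) = x)
    {i j : ι} {x y : X} (h : Linked r {i, j} x y) :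
    ∃ k : ℤ, y = ((r i * r j) ^ k) x ∨ y = r j (((r i * r j) ^ k) x) := by
  induction h with
  | refl => exact ⟨0, Or.inl rfl⟩
  | tail _ hs ih =>
    obtain ⟨m, rfl | rfl, rfl⟩ := hs <;> obtain ⟨k, rfl | rfl⟩ := ih
    · refine ⟨k - 1, Or.inr ?_⟩
      have hk : ((r m * r j) ^ k) x = r m (r j (((r m * r j) ^ (k - 1)) x)) := by
        rw [← Equiv.Perm.mul_apply, ← Equiv.Perm.mul_apply, ← zpow_one_add]
        congr 2
        ring
      rw [hk, hr]
    · refine ⟨1 + k, Or.inl ?_⟩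
      rw [zpow_one_add]
      rfl
    · exact ⟨k, Or.inr rfl⟩
    · exact ⟨k, Or.inl (hr _ _)⟩

namespace IsPolytope

variable {n : ℕ} {α : Type u} [PartialOrder α] [BoundedOrder α] (h : IsPolytope (n + 1) α)
include h

/-- In an orientable polytope, the size of the last entry of the type is the length of the orbit of
a flag under the product of the two last adjacency permutations. -/
theorem encard_last_section {c : Flag α → Bool} (hc : IsFlagColouring c) {l : Fin n}
    (hl : (l : ℕ) + 1 = n) {F G : α} (hF : faceRank F = (n : ℤ) - 2)
    (hG : faceRank G = (n : ℤ) + 1) {Φ : Flag α} (hFΦ : F ∈ Φ) :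
    {H : α | F ≤ H ∧ H ≤ G ∧ faceRank H = (n : ℤ) - 1}.encard =
      ENat.card (ZMod (Function.minimalPeriod
        (fun Ψ => h.adj l.castSucc (h.adj (Fin.last n) Ψ)) Φ)) := by
  rw [h.isFlagColouring_iff] at hc
  set d : Equiv.Perm (Flag α) :=
    h.flagManiplex.r l.castSucc * h.flagManiplex.r (Fin.last n) with hd
  have hdapp : ∀ Ψ, d Ψ = h.adj l.castSucc (h.adj (Fin.last n) Ψ) := fun _ => rfl
  -- Since `l = n - 1`, these are the indices of the ranks `n - 2` and `n - 1`.
  set kF : Fin (n + 3) := l.castSucc.castSucc.castSucc with hkF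
  set kH : Fin (n + 3) := l.castSucc.succ.castSucc with hkH
  have hkFval : (kF : ℕ) = l := rfl
  have hkHval : (kH : ℕ) = l + 1 := rfl
  have hFface : F = h.face Φ kF := h.eq_face hFΦ (by rw [hF, hkFval]; omega)
  have hGtop : G = ⊤ := by
    obtain ⟨Ω, hΩ⟩ := Flag.exists_mem G
    rw [← h.face_last Ω]
    exact h.eq_face hΩ (by rw [hG]; simp)
  have hcol : ∀ (k : ℤ), c ((d ^ k) Φ) = c Φ := fun k =>
    Equiv.Perm.zpow_apply_invariant (fun Ψ => by rw [hdapp, hc, hc, Bool.not_not]) k Φ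
  have hface : ∀ (k : ℤ) (m : Fin (n + 3)), (m : ℕ) ≠ l + 1 → (m : ℕ) ≠ n + 1 →
      h.face ((d ^ k) Φ) m = h.face Φ m := fun k m h1 h2 =>
    Equiv.Perm.zpow_apply_invariant (f := fun Ψ => h.face Ψ m) (fun Ψ => by
      rw [hdapp, h.face_adj (by simpa using h1), h.face_adj (by simpa using h2)]) k Φ
  have hset : {H : α | F ≤ H ∧ H ≤ G ∧ faceRank H = (n : ℤ) - 1} =
      (fun Ψ => h.face Ψ kH) '' Set.range fun k : ℤ => (d ^ k) Φ := by
    ext H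
    constructor
    · rintro ⟨hFH, -, hH⟩
      obtain ⟨Ω, hFΩ, hHΩ⟩ := Flag.exists_mem_mem hFH
      have hH' : H = h.face Ω kH := h.eq_face hHΩ (by rw [hH, hkHval]; omega)
      have hlink : Linked h.flagManiplex.r {j | (j : ℕ) + 1 ≠ l} Φ Ω := by
        refine h.linked_flagManiplex fun j hj => ?_
        simp only [Set.mem_ofPred_eq, not_not] at hj
        have hjF : j.succ.castSucc = kF := Fin.ext (by rw [hkFval]; simp [hj])
        rw [hjF, ← h.face_mem_iff, ← hFface]
        exact hFΩ
      -- A path keeping `F` avoids the colour `n - 2`. Its colours above are `n - 1` and `n`, which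
      -- generate a dihedral action; those below do not move the face of rank `n - 1`.
      obtain ⟨z, hz, hzΩ⟩ := Maniplex.Linked.split_at hlink
      have hz' : Linked h.flagManiplex.r {l.castSucc, Fin.last n} Φ z := hz.mono fun j hj => by
        simp only [Set.mem_ofPred_eq] at hj
        have := j.2
        rcases (by omega : (j : ℕ) = l ∨ (j : ℕ) = n) with e | e
        · exact Or.inl (Fin.ext e)
        · exact Or.inr (Fin.ext e)
      have hzH : h.face z kH = H := by
        rw [hH']
        refine (h.face_eq_of_linked hzΩ fun i hi => ?_).symm
        simp only [Set.mem_ofPred_eq] at hi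
        omega
      obtain ⟨k, rfl | rfl⟩ := Linked.exists_zpow h.flagManiplex.involutive hz'
      · exact ⟨_, ⟨k, rfl⟩, hzH⟩
      · refine ⟨_, ⟨k, rfl⟩, hzH ▸ (h.face_adj ?_).symm⟩
        rw [hkHval]
        simp
        omega
    · rintro ⟨_, ⟨k, rfl⟩, rfl⟩
      refine ⟨?_, hGtop ▸ le_top, ?_⟩
      · rw [hFface, ← hface k kF (by omega) (by omega)]
        exact h.face_le_iff.2 (by rw [Fin.le_def]; omega)
      · rw [h.faceRank_face, hkHval]
        omega
  have hinj : Set.InjOn (fun Ψ => h.face Ψ kH) (Set.range fun k : ℤ => (d ^ k) Φ) := by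
    rintro _ ⟨a, rfl⟩ _ ⟨b, rfl⟩ hab
    -- Two flags of the orbit with the same face of rank `n - 1` are equal or `n`-adjacent; the
    -- colouring, constant on the orbit, rules out the latter.
    have hlink : Linked h.flagManiplex.r {Fin.last n} ((d ^ a) Φ) ((d ^ b) Φ) := by
      refine h.linked_flagManiplex fun j hj => ?_
      by_cases hjl : (j : ℕ) = l
      · obtain rfl : j = l.castSucc := Fin.ext hjl
        exact hab
      · have hjn : (j : ℕ) ≠ n := fun e => hj (Fin.ext e)
        rw [hface a _ (by simpa using hjl) (by simpa using hjn),
          hface b _ (by simpa using hjl) (by simpa using hjn)]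
    rcases Linked.eq_or_eq_of_singleton h.flagManiplex.involutive hlink with e | e
    · exact e.symm
    · have := congrArg c e
      rw [h.flagManiplex_r, hc, hcol, hcol] at this
      simp at this
  have horb : (Set.range fun k : ℤ => (d ^ k) Φ) = MulAction.orbit (Subgroup.zpowers d) Φ := by
    ext Ψ
    constructor
    · rintro ⟨k, rfl⟩
      exact ⟨⟨d ^ k, k, rfl⟩, rfl⟩
    · rintro ⟨⟨_, k, rfl⟩, rfl⟩
      exact ⟨k, rfl⟩
  rw [hset, hinj.encard_image, horb]
  exact ENat.card_congr (MulAction.orbitZPowersEquiv d Φ)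

end IsPolytope

theorem Maniplex.minimalPeriod_mix {n : ℕ} {M₁ M₂ : Maniplex.{u} n} {a : M₁.Flags × M₂.Flags}
    (i j : Fin n) (w : MixFlags M₁ M₂ a) :
    Function.minimalPeriod (fun z => (mix M₁ M₂ a).r i ((mix M₁ M₂ a).r j z)) w =
      Nat.lcm (Function.minimalPeriod (fun z => M₁.r i (M₁.r j z)) w.1.1)
        (Function.minimalPeriod (fun z => M₂.r i (M₂.r j z)) w.1.2) := by
  rw [← Function.minimalPeriod_prodMap]
  exact (minimalPeriod_of_semiconj (X := MixFlags M₁ M₂ a) Subtype.val_injective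
    (g := fun z => (mix M₁ M₂ a).r i ((mix M₁ M₂ a).r j z)) (fun _ => rfl) w).symm

/-! ### Transitivity on the flags of one colour -/

/-- A group of automorphisms containing the abstract rotations has at most two orbits on flags. -/
theorem Maniplex.exists_apply_eq {n : ℕ} {M : Maniplex.{u} (n + 1)} {x : M.Flags}
    {Γ : Subgroup M.aut} (hΓ : ∀ i : Fin n, ∃ γ ∈ Γ,
      (γ : Equiv.Perm M.Flags) x = M.r i.castSucc (M.r i.succ x)) (y : M.Flags) :
    ∃ γ ∈ Γ, y = (γ : Equiv.Perm M.Flags) x ∨ y = (γ : Equiv.Perm M.Flags) (M.r 0 x) := by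
  have hr : ∀ i, ∃ γ ∈ Γ, M.r i x = (γ : Equiv.Perm M.Flags) (M.r 0 x) := by
    intro i
    induction i using Fin.induction with
    | zero => exact ⟨1, one_mem _, rfl⟩
    | succ i ih =>
      obtain ⟨δ, hδ, e⟩ := ih
      obtain ⟨γ, hγ, e'⟩ := hΓ i
      refine ⟨γ * δ, mul_mem hγ hδ, ?_⟩
      -- If `γ x = r_i r_{i+1} x`, then `γ (r_i x) = r_{i+1} x`, so all neighbours of `x` lie in one
      -- orbit.
      rw [Subgroup.coe_mul, Equiv.Perm.mul_apply, ← e, aut_r, e', M.involutive]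
  have hl := M.linked_univ x y
  induction hl with
  | refl => exact ⟨1, one_mem _, Or.inl rfl⟩
  | tail _ hs ih =>
    obtain ⟨i, -, rfl⟩ := hs
    obtain ⟨δ, hδ, e⟩ := hr i
    obtain ⟨γ, hγ, rfl | rfl⟩ := ih
    · refine ⟨γ * δ, mul_mem hγ hδ, Or.inr ?_⟩
      rw [← aut_r, e]
      rfl
    · refine ⟨γ * δ⁻¹, mul_mem hγ (inv_mem hδ), Or.inl ?_⟩
      have : M.r i (M.r 0 x) = ((δ⁻¹ : M.aut) : Equiv.Perm M.Flags) x := by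
        apply (δ : Equiv.Perm M.Flags).injective
        rw [aut_r, ← e, M.involutive]
        exact (Equiv.apply_symm_apply _ _).symm
      rw [← aut_r, this]
      rfl

theorem IsPolytope.exists_abstractRotation {N : ℕ} {α : Type u} [PartialOrder α] [BoundedOrder α]
    (h : IsPolytope N α) (hα : IsRotaryPolytope α) (Φ : Flag α) {a b : Fin N}
    (hab : (a : ℕ) + 1 = b) : ∃ γ : α ≃o α, IsAbstractRotation Φ b γ := by
  have hw : h.adj a (h.adj b Φ) ∈ whiteFlags Φ := fun c hc => by
    rw [h.isFlagColouring_iff] at hc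
    rw [hc, hc, Bool.not_not]
  obtain ⟨γ, -, hγ⟩ := hα Φ Φ (fun _ _ => rfl) _ hw
  refine ⟨γ, by omega, h.adj b Φ, h.flagAdj_adj b Φ, ?_⟩
  rw [hγ, ← hab]
  have := h.flagAdj_adj a (h.adj b Φ)
  simpa using this

theorem IsPolytope.map_eq_of_isAbstractRotation {N : ℕ} {α : Type u} [PartialOrder α]
    [BoundedOrder α] (h : IsPolytope N α) {Φ : Flag α} {i : ℕ} {γ : α ≃o α}
    (hγ : IsAbstractRotation Φ i γ) :
    ∃ a b : Fin N, (a : ℕ) + 1 = i ∧ (b : ℕ) = i ∧ Flag.map γ Φ = h.adj a (h.adj b Φ) := by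
  obtain ⟨h1, Φ₁, hb, ha⟩ := hγ
  obtain ⟨b, hbi⟩ := h.exists_of_flagAdj hb
  obtain ⟨a, hai⟩ := h.exists_of_flagAdj ha
  refine ⟨a, b, by omega, by omega, ?_⟩
  rw [hbi] at hb
  rw [hai] at ha
  rw [← h.flagAdj_iff.1 hb, ← h.flagAdj_iff.1 ha]

theorem IsPolytope.isAbstractRotation_of_map_eq {N : ℕ} {α : Type u} [PartialOrder α]
    [BoundedOrder α] (h : IsPolytope N α) {Φ : Flag α} {i : ℕ} {γ : α ≃o α} {a b : Fin N}
    (ha : (a : ℕ) + 1 = i) (hb : (b : ℕ) = i) (hγ : Flag.map γ Φ = h.adj a (h.adj b Φ)) :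
    IsAbstractRotation Φ i γ := by
  refine ⟨by omega, h.adj b Φ, hb ▸ h.flagAdj_adj b Φ, ?_⟩
  rw [hγ, ← ha]
  have := h.flagAdj_adj a (h.adj b Φ)
  simpa using this

/-! ### The mix of a chiral extension and `2s^(R - 1)` -/

/-- The mix of the flag graph of an extension `P` of `K` with `2s^(R - 1)`, where `K` covers the
regular maniplex `R`, covers `P`, and the covering is injective on facets. -/
theorem mix_twoS_injOn_facet {n : ℕ} {K P : Type u} [PartialOrder K] [PartialOrder P]
    [BoundedOrder P] (hP : IsPolytope (n + 1) P) (hPext : IsExtension n K P) {R : Maniplex.{u} n}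
    (hKR : PolytopeCovers K R) (hR : R.IsRegular) (x₀ : R.Flags) (s : ℕ)
    {a : hP.flagManiplex.Flags × (R.twoS x₀ s).Flags}
    (x y : Maniplex.MixFlags hP.flagManiplex (R.twoS x₀ s) a)
    (hxy : Linked (Maniplex.mix hP.flagManiplex (R.twoS x₀ s) a).r {Fin.last n}ᶜ x y)
    (h : x.1.1 = y.1.1) : x = y := by
  obtain ⟨⟨Φ, z, v, d⟩, hx⟩ := x
  obtain ⟨ψ, hψx, hψ⟩ := exists_facet_cover hP hPext hKR hR Φ z
  -- Along a path inside the facet the `R`-coordinate follows `ψ` and `(v, d)` is constant, since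
  -- only the last colour changes it.
  have key : ∀ y : Maniplex.MixFlags hP.flagManiplex (R.twoS x₀ s) a,
      Linked (Maniplex.mix hP.flagManiplex (R.twoS x₀ s) a).r {Fin.last n}ᶜ ⟨(Φ, z, v, d), hx⟩ y →
      hP.face y.1.1 (Fin.last n).succ.castSucc = hP.face Φ (Fin.last n).succ.castSucc ∧
        y.1.2 = ((ψ y.1.1, v, d) : R.TwoSFlags s) := by
    intro y hy
    induction hy with
    | refl => exact ⟨rfl, by rw [hψx]⟩
    | @tail y _ _ hs ih =>
      obtain ⟨i, hi, rfl⟩ := hs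
      obtain ⟨j, rfl⟩ : ∃ j : Fin n, i = j.castSucc :=
        ⟨i.castPred hi, (Fin.castSucc_castPred i hi).symm⟩
      refine ⟨(hP.face_adj ?_).trans ih.1, ?_⟩
      · have := j.2
        simp
        omega
      · change (R.twoS x₀ s).r j.castSucc y.1.2 = ((ψ (hP.adj j.castSucc y.1.1), v, d) :
          R.TwoSFlags s)
        rw [ih.2, Maniplex.twoS_r_castSucc, hψ _ ih.1]
  have hy := (key y hxy).2
  refine Subtype.ext (Prod.ext h ?_)
  rw [hy, ← h, hψx]

theorem Maniplex.IsPolytopal.adj_flagOf {n : ℕ} {M : Maniplex.{u} n} (hM : M.IsPolytopal)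
    (i : Fin n) (x : M.Flags) : hM.isPolytope.adj i (flagOf x) = flagOf (M.r i x) :=
  (hM.isPolytope.flagAdj_iff.1 (hM.flagAdj_iff.2 rfl)).symm

theorem theorem4p3 (n : ℕ) (p : ℕ → ℕ∞) (q : ℕ∞)
    (K : Type u) [PartialOrder K] [BoundedOrder K]
    (hK : IsPolytope n K) (hKchiral : IsChiralPolytope K) (hKtype : HasSchlafliType n K p)
    (R : Maniplex.{u} n) (hKR : PolytopeCovers K R) (hRreg : R.IsRegular)
    (hRfacets : Nontrivial R.Facet)
    (P : Type u) [PartialOrder P] [BoundedOrder P]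
    (hP : IsPolytope (n + 1) P) (hPchiral : IsChiralPolytope P) (hPext : IsExtension n K P)
    (hPtype : HasSchlafliType (n + 1) P (Function.update p n q))
    (Φ₀ : Flag P) (x₀ : R.Flags) (s : ℕ) (hs : 1 ≤ s) :
    ∃ (Q : Type u) (_ : PartialOrder Q) (_ : BoundedOrder Q),
      IsPolytope (n + 1) Q ∧ IsChiralPolytope Q ∧ IsExtension n K Q ∧
      HasSchlafliType (n + 1) Q (Function.update p n (lcmTop q (2 * s))) ∧
      ∃ (Ψ₀ : Flag Q)
        (f : rotationGroup Ψ₀ ≃* rotationMix Φ₀ (R.twoS x₀ s) (R.twoSBase x₀ s)),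
        ∀ (i : ℕ) (γ : rotationGroup Ψ₀), IsAbstractRotation Ψ₀ i (γ : Q ≃o Q) →
          IsAbstractRotation Φ₀ i (f γ : (P ≃o P) × (R.twoS x₀ s).aut).1 ∧
          (R.twoS x₀ s).IsAbstractRotation (R.twoSBase x₀ s) i
            (f γ : (P ≃o P) × (R.twoS x₀ s).aut).2 := by
  set T := R.twoS x₀ s with hT
  set a : hP.flagManiplex.Flags × T.Flags := (Φ₀, R.twoSBase x₀ s) with ha
  set X := Maniplex.mix hP.flagManiplex T a with hX
  let π : X.Flags → Flag P := fun w => w.1.1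
  have hπ : ∀ i x, π (X.r i x) = hP.adj i (π x) := fun _ _ => rfl
  have hinj : ∀ x y, Linked X.r {Fin.last n}ᶜ x y → π x = π y → x = y :=
    mix_twoS_injOn_facet hP hPext hKR hRreg x₀ s
  have hXpoly : X.IsPolytopal := hP.isPolytopal_flagManiplex.of_cover π hπ hinj
  have hQ : IsPolytope (n + 1) X.Poset := hXpoly.isPolytope
  have hQext : IsExtension n K X.Poset := Maniplex.isExtension_poset hP hπ hinj hPext
  obtain ⟨c, hc⟩ := hPchiral.exists_colouring
  have hcP := hP.isFlagColouring_iff.1 hc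
  let e : X.Flags ≃ Flag X.Poset :=
    Equiv.ofBijective Maniplex.flagOf ⟨hXpoly.flagOf_injective, Maniplex.flagOf_surjective⟩
  let cQ : Flag X.Poset → Bool := fun Ψ => c (π (e.symm Ψ))
  have hcQ_apply : ∀ x, cQ (Maniplex.flagOf x) = c (π x) := fun x =>
    congrArg (fun z => c (π z)) (e.symm_apply_apply x)
  have hcQ : IsFlagColouring cQ := hQ.isFlagColouring_iff.2 fun i Ψ => by
    obtain ⟨x, rfl⟩ := Maniplex.flagOf_surjective Ψ
    rw [hXpoly.adj_flagOf, hcQ_apply, hcQ_apply, hπ, hcP]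
  -- the mix of the rotation groups acts on the flags
  set G := rotationMix Φ₀ T (R.twoSBase x₀ s) with hG
  let η : (P ≃o P) × T.aut →* hP.flagManiplex.aut × T.aut :=
    hP.autHom.prodMap (MonoidHom.id T.aut)
  have hη : Function.Injective η := by
    rintro ⟨γ, δ⟩ ⟨γ', δ'⟩ h
    have h1 : hP.autHom γ = hP.autHom γ' := congrArg Prod.fst h
    have h2 : δ = δ' := congrArg Prod.snd h
    have h3 : Flag.map γ Φ₀ = Flag.map γ' Φ₀ :=
      congrArg (fun g : hP.flagManiplex.aut => g.1 Φ₀) h1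
    rw [h2, hP.orderIso_ext h3]
  -- A pair of corresponding abstract rotations moves `a` along two edges of equal colours in both
  -- coordinates, so it preserves the component of `a`.
  have hGmix : G ≤ (Maniplex.mixGroup a).comap η := by
    rw [hG, rotationMix, Subgroup.closure_le]
    rintro ⟨γ, δ⟩ ⟨i, hγ, ⟨j, k, hj, hk, hδ⟩⟩
    obtain ⟨j', k', hj', hk', hγ⟩ := hP.map_eq_of_isAbstractRotation hγ
    obtain rfl : j' = j := Fin.ext (by omega)
    obtain rfl : k' = k := Fin.ext (by omega)
    have h2 : Linked (Maniplex.prodPerm hP.flagManiplex T) Set.univ a _ :=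
      ((Linked.refl a).tail (Set.mem_univ k')).tail (Set.mem_univ j')
    have h3 : Maniplex.prodPerm hP.flagManiplex T j' (Maniplex.prodPerm hP.flagManiplex T k' a) =
        (Flag.map γ Φ₀, (δ : Equiv.Perm T.Flags) (R.twoSBase x₀ s)) :=
      Prod.ext hγ.symm hδ.symm
    rw [h3] at h2
    exact h2
  let θ : G →* X.aut := (Maniplex.mixHom a).comp
    ((η.comp G.subtype).codRestrict (Maniplex.mixGroup a) fun g => hGmix g.2)
  have hθ : Function.Injective θ := by
    refine (Maniplex.mixHom_injective a).comp fun g g' h => ?_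
    exact Subtype.ext (hη (congrArg Subtype.val h))
  let base : X.Flags := (⟨a, Linked.refl a⟩ : Maniplex.MixFlags hP.flagManiplex T a)
  have hθπ : ∀ (g : G) (x : X.Flags), π ((θ g : Equiv.Perm X.Flags) x) =
      Flag.map (g : (P ≃o P) × T.aut).1 (π x) := fun _ _ => rfl
  have hGcol : ∀ g ∈ G, ∀ Ψ, c (Flag.map g.1 Ψ) = c Ψ := by
    intro g hg
    rw [hG, rotationMix] at hg
    have hcomp : ∀ (γ γ' : P ≃o P) (Ψ : Flag P),
        Flag.map (γ * γ') Ψ = Flag.map γ (Flag.map γ' Ψ) := fun γ γ' Ψ =>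
      Flag.ext (Set.image_comp γ γ' Ψ.carrier)
    induction hg using Subgroup.closure_induction with
    | mem g hg =>
      obtain ⟨i, hi, -⟩ := hg
      obtain ⟨j, k, -, -, h⟩ := hP.map_eq_of_isAbstractRotation hi
      exact hP.comp_map_colouring hc (by rw [h, hcP, hcP, Bool.not_not])
    | one => exact fun Ψ => congrArg c (Flag.ext (Set.image_id _))
    | mul g g' _ _ ih ih' =>
      intro Ψ
      rw [Prod.fst_mul, hcomp, ih, ih']
    | inv g _ ih =>
      intro Ψ
      rw [← ih (Flag.map g⁻¹.1 Ψ), ← hcomp, ← Prod.fst_mul, mul_inv_cancel]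
      exact congrArg c (Flag.ext (Set.image_id _))
  have hrot : ∀ i : Fin n, ∃ γ ∈ θ.range,
      (γ : Equiv.Perm X.Flags) base = X.r i.castSucc (X.r i.succ base) := by
    intro i
    have hab : ((i.castSucc : Fin (n + 1)) : ℕ) + 1 = (i.succ : Fin (n + 1)) := by simp
    obtain ⟨γ, hγ⟩ := hP.exists_abstractRotation hPchiral.1 Φ₀ hab
    obtain ⟨δ, hδ⟩ := Maniplex.exists_twoS_abstractRotation s x₀ hRreg
      (i := (i.succ : Fin (n + 1))) (by simp) (by simp)
    have hg : (γ, δ) ∈ G := Subgroup.subset_closure ⟨_, hγ, hδ⟩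
    refine ⟨θ ⟨(γ, δ), hg⟩, ⟨_, rfl⟩, ?_⟩
    obtain ⟨j', k', hj', hk', hγ⟩ := hP.map_eq_of_isAbstractRotation hγ
    obtain ⟨j, k, hj, hk, hδ⟩ := hδ
    obtain rfl : j' = i.castSucc := Fin.ext (by omega)
    obtain rfl : k' = i.succ := Fin.ext (by omega)
    obtain rfl : j = i.castSucc := Fin.ext (by omega)
    obtain rfl : k = i.succ := Fin.ext (by omega)
    exact Subtype.ext (Prod.ext hγ hδ)
  let Θ : G →* (X.Poset ≃o X.Poset) := (Maniplex.posetHom X).comp θ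
  have hΘ : ∀ (g : G) (x : X.Flags), Flag.map (Θ g) (Maniplex.flagOf x) =
      Maniplex.flagOf ((θ g : Equiv.Perm X.Flags) x) := fun g x =>
    Maniplex.map_posetHom_flagOf (θ g) x
  have hΘcol : ∀ (g : G) (Ψ : Flag X.Poset), cQ (Flag.map (Θ g) Ψ) = cQ Ψ := by
    intro g Ψ
    obtain ⟨x, rfl⟩ := Maniplex.flagOf_surjective Ψ
    rw [hΘ, hcQ_apply, hcQ_apply, hθπ, hGcol g g.2]
  have horbit : ∀ y : X.Flags, ∃ g : G, y = (θ g : Equiv.Perm X.Flags) base ∨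
      y = (θ g : Equiv.Perm X.Flags) (X.r 0 base) := by
    intro y
    obtain ⟨_, ⟨g, rfl⟩, h⟩ := Maniplex.exists_apply_eq hrot y
    exact ⟨g, h⟩
  have htrans : ∀ Φ Ψ : Flag X.Poset, cQ Φ = cQ Ψ → ∃ g : G, Flag.map (Θ g) Φ = Ψ := by
    have key : ∀ (b : X.Flags) (g h : G),
        Flag.map (Θ (h * g⁻¹)) (Maniplex.flagOf ((θ g : Equiv.Perm X.Flags) b)) =
          Maniplex.flagOf ((θ h : Equiv.Perm X.Flags) b) := by
      intro b g h
      rw [hΘ, ← Equiv.Perm.mul_apply, ← Subgroup.coe_mul, ← map_mul, inv_mul_cancel_right]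
    have hcolθ : ∀ (g : G) (x : X.Flags), c (π ((θ g : Equiv.Perm X.Flags) x)) = c (π x) :=
      fun g x => by rw [hθπ, hGcol g g.2]
    intro Φ Ψ h
    obtain ⟨x, rfl⟩ := Maniplex.flagOf_surjective Φ
    obtain ⟨y, rfl⟩ := Maniplex.flagOf_surjective Ψ
    rw [hcQ_apply, hcQ_apply] at h
    -- The flag `base` and its `0`-neighbour have opposite colours and `G` preserves colours, so
    -- flags of the same colour lie in the same orbit.
    obtain ⟨g, rfl | rfl⟩ := horbit x <;> obtain ⟨g', rfl | rfl⟩ := horbit y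
    · exact ⟨_, key _ g g'⟩
    · rw [hcolθ, hcolθ, hπ, hcP] at h
      simp at h
    · rw [hcolθ, hcolθ, hπ, hcP] at h
      simp at h
    · exact ⟨_, key _ g g'⟩
  have hΘrot : ∀ (Φ : Flag X.Poset) (g : G), Θ g ∈ rotationGroup Φ := by
    intro Φ g Ψ
    rw [hQ.mem_whiteFlags_iff hcQ, hQ.mem_whiteFlags_iff hcQ, hΘcol]
  refine ⟨X.Poset, inferInstance, inferInstance, hQ, ⟨?_, ?_⟩, hQext, ?_, Maniplex.flagOf base, ?_⟩
  · intro Φ Ψ hΨ Ω hΩ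
    rw [hQ.mem_whiteFlags_iff hcQ] at hΨ hΩ
    obtain ⟨g, hg⟩ := htrans Ψ Ω (hΨ.trans hΩ.symm)
    exact ⟨Θ g, hΘrot Φ g, hg⟩
  · exact fun hreg => hKchiral.2 (hQext.isRegularPolytope hQ hreg)
  · intro i h1 hi F G hF hG hFG
    rcases Nat.lt_succ_iff_lt_or_eq.1 hi with hin | rfl
    · rw [Function.update_of_ne hin.ne]
      exact hQext.encard_section hQ hKtype h1 hin hF hG hFG
    · rw [Function.update_self]
      obtain ⟨Φ, hFΦ⟩ := Flag.exists_mem F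
      obtain ⟨w, rfl⟩ := Maniplex.flagOf_surjective Φ
      have hl : ((⟨i - 1, by omega⟩ : Fin i) : ℕ) + 1 = i := by simp; omega
      set l : Fin i := ⟨i - 1, by omega⟩
      have hper : Function.minimalPeriod
          (fun Ψ => hQ.adj l.castSucc (hQ.adj (Fin.last i) Ψ)) (Maniplex.flagOf w) =
          Function.minimalPeriod (fun z => X.r l.castSucc (X.r (Fin.last i) z)) w :=
        minimalPeriod_of_semiconj hXpoly.flagOf_injective
          (fun x => by rw [hXpoly.adj_flagOf, hXpoly.adj_flagOf]) w
      have hmix : Function.minimalPeriod (fun z => X.r l.castSucc (X.r (Fin.last i) z)) w =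
          Nat.lcm (Function.minimalPeriod
            (fun Ψ => hP.adj l.castSucc (hP.adj (Fin.last i) Ψ)) (π w)) (2 * s) :=
        (Maniplex.minimalPeriod_mix l.castSucc (Fin.last i) w).trans
          (congrArg (Nat.lcm _) (Maniplex.minimalPeriod_twoS s x₀ hRreg hRfacets hl _))
      rw [hQ.encard_last_section hcQ hl hF hG hFΦ, hper, hmix, card_zmod_lcm _ (by omega)]
      -- What remains is the period in `P` at the flag `π w`, which the type of `P` identifies with
      -- `q`.
      congr 1
      have hFP := hP.faceRank_face (π w) l.castSucc.castSucc.castSucc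
      have hGP := hP.faceRank_face (π w) (Fin.last (i + 2))
      simp only [Fin.val_castSucc, Fin.val_last] at hFP hGP
      have hFP' : faceRank (hP.face (π w) l.castSucc.castSucc.castSucc) = (i : ℤ) - 2 := by
        rw [hFP]; omega
      have hGP' : faceRank (hP.face (π w) (Fin.last (i + 2))) = (i : ℤ) + 1 := by
        rw [hGP]; omega
      have := hPtype i h1 hi _ _ hFP' hGP' (hP.face_le_iff.2 (Fin.le_last _))
      rw [Function.update_self, hP.encard_last_section hc hl hFP' hGP' (hP.face_mem _ _)] at this
      exact this
  · let f : G →* rotationGroup (Maniplex.flagOf base) :=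
      Θ.codRestrict _ fun g => hΘrot _ g
    have hf : Function.Bijective f := by
      constructor
      · intro g g' h
        have h1 : Θ g = Θ g' := congrArg Subtype.val h
        have h2 := hΘ g base
        rw [h1, hΘ] at h2
        exact hθ (Maniplex.aut_ext (hXpoly.flagOf_injective h2)).symm
      -- A rotation sends the base flag to a white flag, which some element of `G` also reaches; the
      -- two automorphisms then agree.
      · rintro ⟨δ, hδ⟩
        have hw := (hδ (Maniplex.flagOf base)).2 fun _ _ => rfl
        rw [hQ.mem_whiteFlags_iff hcQ] at hw
        obtain ⟨g, hg⟩ := htrans _ _ hw.symm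
        exact ⟨g, Subtype.ext (hQ.orderIso_ext hg)⟩
    -- The action goes from the mix to the rotation group, so its inverse is taken. The image of the
    -- base pair under `g` is compared with the image of the base flag in each coordinate.
    refine ⟨(MulEquiv.ofBijective f hf).symm, fun i γ hγ => ?_⟩
    obtain ⟨g, rfl⟩ := (MulEquiv.ofBijective f hf).surjective γ
    rw [MulEquiv.symm_apply_apply]
    obtain ⟨j, k, hj, hk, h⟩ := hQ.map_eq_of_isAbstractRotation hγ
    have h1 : Maniplex.flagOf ((θ g : Equiv.Perm X.Flags) base) =
        Maniplex.flagOf (X.r j (X.r k base)) := by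
      rw [← hΘ, ← hXpoly.adj_flagOf, ← hXpoly.adj_flagOf]
      exact h
    have h2 := congrArg Subtype.val (hXpoly.flagOf_injective h1)
    exact ⟨hP.isAbstractRotation_of_map_eq hj hk (congrArg Prod.fst h2),
      ⟨j, k, hj, hk, congrArg Prod.snd h2⟩⟩
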